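/- Let $d\ge 1$ and let $H$ be a connected graph on $k\ge 1$ vertices with diameter $\operatorname{diam}(H)$. Write $B(0,r)$ for the closed Euclidean ball of radius $r$ around the origin in $\mathbb R^d$. Let $\theta\ge 1$ and let $S\subseteq\mathbb R^d$ be a Borel set with $S=-S$ and $B(0,1)\subseteq S\subseteq B(0,\theta)$. Let $(\rho_t)_{t\ge 1}$ be a sequence of positive real numbers with $\rho_t\to 0$ as $t\to\infty$. Let $m:\mathbb R^d\to[0,\infty)$ be continuous, bounded and not identically zero, and assume that $$\int_{\mathbb R^d} m(x)^k\,dx<\infty$$ and that there is a constant $c\ge 1$ such that $$m(x)\le c\,m(y)\quad\text{whenever}\quad \|x-y\|\le \operatorname{diam}(H)\,\theta\,\sup_{t\ge 1}\rho_t .$$ Let $\mu$ be the measure with Lebesgue density $m$ (it may be infinite) and, for each integer $t\ge 1$, let $\eta_t$ be a Poisson point process on $\mathbb R^d$ with intensity measure $t\mu$. Let $N_t$ be the number of (not necessarily induced) subgraphs isomorphic to $H$ in the random geometric graph with vertex set $\eta_t$ in which distinct points $x,y$ are joined by an edge whenever $x-y\in\rho_tS$; that is, $$N_t=\sum_{(x_1,\dots,x_k)}\frac{1}{k!}\,\bigl|\{H'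 \text{ subgraph of } \mathfrak G_{\rho_tS}(\{x_1,\dots,x_k\}) : H'\cong H\}\bigr| ,$$ where the sum runs over all $k$-tuples of pairwise distinct points of $\eta_t$, and $\mathfrak G_{\rho_tS}(\xi)$ is the graph on $\xi$ with the edges just described. Write $\mathbb M Z=\inf\{x\in\mathbb R:\mathbb P(Z\le x)\ge 1/2\}$ for the smallest median of a real random variable $Z$, and $a_t\sim b_t$ for $\lim_{t\to\infty}a_t/b_t=1$. Then each $N_t$ is almost surely finite and square-integrable, and the following holds. (i) There exists a constant $a>0$ such that $\mathbb E N_t\sim a\,t^k\rho_t^{d(k-1)}$. (ii) If $\lim_{t\to\infty}\mathbb E N_t=\infty$, then $\mathbb M N_t\sim\mathbb E N_t$. (iii) There exist constants $A^{(n)}>0$ for $1\le n\le k$ such that $$\mathbb V N_t\sim t^k\rho_t^{d(k-1)}\sum_{n=1}^k (t\rho_t^d)^{k-n}A^{(n)} .$$ -/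

import Mathlib

open MeasureTheory ProbabilityTheory Filter Topology
open scoped ENNReal NNReal Pointwise Nat

noncomputable section

/-- Locally finite point configurations in `ℝ^d`: the sets with finitely many points in every
closed ball around the origin. -/
def PointConfig (d : ℕ) : Type :=
  {ξ : Set (EuclideanSpace ℝ (Fin d)) // ∀ r : ℝ, (ξ ∩ Metric.closedBall 0 r).Finite}

namespace PointConfig

variable {d : ℕ}

/-- The underlying set of points. -/
def points (ξ : PointConfig d) : Set (EuclideanSpace ℝ (Fin d)) := ξ.1

/-- The number `ξ(A)` of points of the configuration `ξ` in the set `A`. -/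
def count (A : Set (EuclideanSpace ℝ (Fin d))) (ξ : PointConfig d) : ℕ∞ :=
  (ξ.points ∩ A).encard

/-- The σ-algebra on point configurations generated by the maps `ξ ↦ ξ(A)`, `A` Borel. -/
instance : MeasurableSpace (PointConfig d) :=
  ⨆ (A : Set (EuclideanSpace ℝ (Fin d))) (_ : MeasurableSet A),
    MeasurableSpace.comap (count A) inferInstance

end PointConfig

/-- `η` is a Poisson point process on `ℝ^d` with intensity measure `ν`: a random locally finite
point configuration such that the number of points in a Borel set `A` with `ν A < ∞` is Poisson
distributed with parameter `ν A`, and such that the numbers of points in pairwise disjoint Borel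
sets are independent. -/
structure IsPoissonProcess {d : ℕ} {Ω : Type*} [MeasurableSpace Ω] (P : Measure Ω)
    (ν : Measure (EuclideanSpace ℝ (Fin d))) (η : Ω → PointConfig d) : Prop where
  measurable : Measurable η
  map_count : ∀ A : Set (EuclideanSpace ℝ (Fin d)), MeasurableSet A → ν A ≠ ∞ →
    P.map (fun ω => (η ω).count A) =
      (poissonMeasure (ν A).toNNReal).map (fun n : ℕ => (n : ℕ∞))
  indep_count : ∀ (n : ℕ) (A : Fin n → Set (EuclideanSpace ℝ (Fin d))),
    (∀ i, MeasurableSet (A i)) → (∀ i j, i ≠ j → Disjoint (A i) (A j)) →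
      iIndepFun (fun i ω => (η ω).count (A i)) P

/-- The geometric graph on the vertex set `ξ`: two distinct points `x`, `y` are joined by an edge
whenever `x - y ∈ S` (for a symmetric set `S`; `SimpleGraph.fromRel` symmetrizes the relation
otherwise). -/
def geomGraph {d : ℕ} (S ξ : Set (EuclideanSpace ℝ (Fin d))) : SimpleGraph ξ :=
  SimpleGraph.fromRel (fun x y : ξ => (x : EuclideanSpace ℝ (Fin d)) - y ∈ S)

/-- The kernel `f_H(x₁, …, x_k)`: the number of (not necessarily induced) subgraphs of the geometric
graph on `{x₁, …, x_k}` that are isomorphic to `H`, divided by `k!`. -/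
def subgraphKernel {d k : ℕ} (H : SimpleGraph (Fin k)) (S : Set (EuclideanSpace ℝ (Fin d)))
    (x : Fin k → EuclideanSpace ℝ (Fin d)) : ℝ≥0∞ :=
  (Nat.card {H' : (geomGraph S (Set.range x)).Subgraph // Nonempty (H'.coe ≃g H)} : ℝ≥0∞) / (k ! : ℝ≥0∞)

/-- The U-statistic of order `k` with kernel `f ≥ 0`: the sum of `f` over all `k`-tuples of
pairwise distinct points of `ξ`. -/
def uStatistic {d k : ℕ} (f : (Fin k → EuclideanSpace ℝ (Fin d)) → ℝ≥0∞)
    (ξ : PointConfig d) : ℝ≥0∞ :=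
  ∑' x : {x : Fin k → EuclideanSpace ℝ (Fin d) // Function.Injective x ∧ ∀ i, x i ∈ ξ.points},
    f x.1

/-- The subgraph count `N^H` of the geometric graph on `ξ`; it may be infinite. -/
def subgraphCount {d k : ℕ} (H : SimpleGraph (Fin k)) (S : Set (EuclideanSpace ℝ (Fin d)))
    (ξ : PointConfig d) : ℝ≥0∞ :=
  uStatistic (subgraphKernel H S) ξ

/-- The smallest median `inf {x : P(Z ≤ x) ≥ 1/2}` of a real random variable `Z`. -/
def smallestMedian {Ω : Type*} [MeasurableSpace Ω] (P : Measure Ω) (Z : Ω → ℝ) : ℝ :=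
  sInf {x : ℝ | (1 / 2 : ℝ≥0∞) ≤ P {ω | Z ω ≤ x}}

/-- Asymptotic equivalence `a_t ∼ b_t`: the quotient `a_t / b_t` tends to `1` as `t → ∞`. -/
def AsympEquiv (a b : ℕ+ → ℝ) : Prop :=
  Tendsto (fun t => a t / b t) atTop (𝓝 1)

end

/-!
The count is a U-statistic: a sum, over `k`-tuples of distinct points, of the number of copies of
`H` in the geometric graph on the tuple, divided by `k!`. All moments needed follow from
Campbell's formula: the expected sum of a kernel over the `p`-tuples of distinct points of a
Poisson process is the integral of the kernel against the `p`-th power of the intensity measure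
(`IsPoissonProcess.bind_factorialMeasure`). Both sides are measures carried by the injective
tuples, which countably many rectangles with disjoint bounded sides cover; on such a rectangle the
formula says that the numbers of points in disjoint sets are independent with the right means.

The square of the count is a sum over pairs of tuples. Sorting the pairs by the equivalence
relation that says which entries coincide (`PairPattern`) turns it into a finite sum of
U-statistics (`lintegral_factorialMeasure_mul`). The relation without coincidences contributes the
square of the mean, so the variance is the sum over the other relations
(`IsPoissonProcess.lintegral_sq`). For these, two copies of the connected graph `H` share a point,
and all their points lie within the range `diam H * θ * ρ t` of it.

A kernel in `p` points with this locality, blown up around such a point, gives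
`t ^ p * ρ t ^ (d * (p - 1))` times an integral that converges by dominated convergence
to `∫ m ^ p` times a positive constant
(`tendsto_lintegral_local`, `exists_tendsto_lintegral_scaledIntensity`). The
comparability of `m` gives the dominating function, and the ball contained in `S` the positivity.
With `p = k` this is the mean; with `p = 2 * k - n` for `n` common points it is the `n`-th term of
the variance. Finally, by Chebyshev's inequality the median is equivalent to the mean as soon as
the variance is negligible against the square of the mean (`asympEquiv_smallestMedian`), and each
term of the variance is so when the mean tends to infinity (`tendsto_div_sq_zero`).
-/

/-! ### Factorial moment measures of a point process -/

section FactorialMoments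

variable {d : ℕ} {ι : Type} [Fintype ι]

/-- The tuples of pairwise distinct points of a configuration, indexed by `ι`. -/
def distinctTuples (ι : Type) (ξ : PointConfig d) : Set (ι → EuclideanSpace ℝ (Fin d)) :=
  {x | Function.Injective x ∧ ∀ i, x i ∈ ξ.points}

/-- The factorial measure of a configuration: the counting measure of the `ι`-tuples of pairwise
distinct points. Integrating `f` against it sums `f` over these tuples. -/
noncomputable def factorialMeasure (ι : Type) (ξ : PointConfig d) :
    Measure (ι → EuclideanSpace ℝ (Fin d)) :=
  Measure.count.restrict (distinctTuples ι ξ)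

theorem PointConfig.countable_points (ξ : PointConfig d) : ξ.points.Countable := by
  have h : ξ.points = ⋃ n : ℕ, ξ.points ∩ Metric.closedBall 0 n := by
    rw [← Set.inter_iUnion, Metric.iUnion_closedBall_nat, Set.inter_univ]
  rw [h]
  exact Set.countable_iUnion fun n => (ξ.2 n).countable

theorem countable_distinctTuples (ξ : PointConfig d) : (distinctTuples ι ξ).Countable := by
  refine Set.Countable.mono (fun x hx => ?_)
    (Set.countable_univ_pi (s := fun _ : ι => ξ.points) fun _ => ξ.countable_points)
  exact fun i _ => hx.2 i

theorem lintegral_factorialMeasure (f : (ι → EuclideanSpace ℝ (Fin d)) → ℝ≥0∞)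
    (ξ : PointConfig d) :
    ∫⁻ x, f x ∂(factorialMeasure ι ξ) = ∑' x : distinctTuples ι ξ, f x := by
  rw [factorialMeasure, lintegral_countable f (countable_distinctTuples ξ)]
  simp

theorem PointConfig.measurable_count {A : Set (EuclideanSpace ℝ (Fin d))} (hA : MeasurableSet A) :
    Measurable (PointConfig.count A) := by
  refine Measurable.of_comap_le ?_
  exact le_iSup₂_of_le A hA le_rfl

theorem PointConfig.finite_inter (ξ : PointConfig d) {A : Set (EuclideanSpace ℝ (Fin d))}
    (hA : Bornology.IsBounded A) : (ξ.points ∩ A).Finite := by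
  obtain ⟨r, hr⟩ := hA.subset_closedBall 0
  exact (ξ.2 r).subset (Set.inter_subset_inter_right _ hr)

/-- On a rectangle with pairwise disjoint sides distinctness is automatic, so the factorial measure
is the product of the numbers of points in the sides. -/
theorem factorialMeasure_pi (ξ : PointConfig d) {A : ι → Set (EuclideanSpace ℝ (Fin d))}
    (hA : ∀ i, MeasurableSet (A i)) (hb : ∀ i, Bornology.IsBounded (A i))
    (hd : Pairwise fun i j => Disjoint (A i) (A j)) :
    factorialMeasure ι ξ (Set.univ.pi A) = ∏ i, ((ξ.count (A i) : ℕ∞) : ℝ≥0∞) := by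
  classical
  have hfin : ∀ i, (ξ.points ∩ A i).Finite := fun i => ξ.finite_inter (hb i)
  rw [factorialMeasure, Measure.restrict_apply (MeasurableSet.univ_pi hA)]
  have h : Set.univ.pi A ∩ distinctTuples ι ξ
      = ((Fintype.piFinset fun i => (hfin i).toFinset : Finset _) :
          Set (ι → EuclideanSpace ℝ (Fin d))) := by
    ext x
    simp only [distinctTuples, Set.mem_inter_iff, Set.mem_pi, Set.mem_univ, true_imp_iff,
      Set.mem_ofPred_eq, Fintype.coe_piFinset, Set.Finite.coe_toFinset]
    constructor
    · exact fun h i => ⟨h.2.2 i, h.1 i⟩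
    · refine fun h => ⟨fun i => (h i).2, fun i j hij => ?_, fun i => (h i).1⟩
      by_contra hne
      exact Set.disjoint_left.1 (hd hne) (h i).2 (hij ▸ (h j).2)
  rw [h, Measure.count_apply_finset, Fintype.card_piFinset, Nat.cast_prod]
  refine Finset.prod_congr rfl fun i _ => ?_
  rw [PointConfig.count, (hfin i).encard_eq_coe_toFinset_card]
  rfl

variable (ι d) in
/-- The rectangle with index `(n, q)` has as sides the balls of radius `1 / (n + 1)` around the
points with numbers `q i` of a dense sequence. -/
noncomputable def ballBox (p : ℕ × (ι → ℕ)) (i : ι) : Set (EuclideanSpace ℝ (Fin d)) :=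
  Metric.ball (TopologicalSpace.denseSeq (EuclideanSpace ℝ (Fin d)) (p.2 i)) (1 / ((p.1 : ℝ) + 1))

variable (ι d) in
/-- The indices of those rectangles `ballBox` whose sides are pairwise disjoint. -/
abbrev DisjointBox : Type :=
  {p : ℕ × (ι → ℕ) // Pairwise fun i j => Disjoint (ballBox d ι p i) (ballBox d ι p j)}

/-- The rectangles with disjoint sides cover exactly the injective tuples. -/
theorem iUnion_disjointBox :
    ⋃ p : DisjointBox d ι, Set.univ.pi (ballBox d ι p.1) = {x | Function.Injective x} := by
  ext x
  simp only [Set.mem_iUnion, Set.mem_pi, Set.mem_univ, true_imp_iff, Set.mem_ofPred_eq]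
  constructor
  · rintro ⟨p, hp⟩ i j hij
    by_contra hne
    exact Set.disjoint_left.1 (p.2 hne) (hp i) (hij ▸ hp j)
  · intro hx
    obtain ⟨δ, hδ, hsep⟩ : ∃ δ : ℝ, 0 < δ ∧ ∀ i j, i ≠ j → δ ≤ dist (x i) (x j) := by
      classical
      by_cases hne : (Finset.univ.filter fun p : ι × ι => p.1 ≠ p.2).Nonempty
      · obtain ⟨p, hp, hmin⟩ := Finset.exists_min_image _
          (fun p : ι × ι => dist (x p.1) (x p.2)) hne
        refine ⟨_, dist_pos.2 (hx.ne (Finset.mem_filter.1 hp).2), fun i j hij => ?_⟩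
        exact hmin (i, j) (by simpa using hij)
      · refine ⟨1, one_pos, fun i j hij => absurd ⟨(i, j), ?_⟩ hne⟩
        simpa using hij
    obtain ⟨n, hn⟩ := exists_nat_one_div_lt (show (0 : ℝ) < δ / 4 by positivity)
    have hq : ∀ i, ∃ q : ℕ, dist (x i) (TopologicalSpace.denseSeq (EuclideanSpace ℝ (Fin d)) q)
        < 1 / ((n : ℝ) + 1) := fun i => by
      exact (TopologicalSpace.denseRange_denseSeq
        (EuclideanSpace ℝ (Fin d))).exists_dist_lt (x i)
          (show (0 : ℝ) < 1 / ((n : ℝ) + 1) by positivity)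
    choose q hq using hq
    refine ⟨⟨(n, q), fun i j hij => ?_⟩, fun i => hq i⟩
    refine Set.disjoint_left.2 fun y hy hy' => ?_
    simp only [ballBox, Metric.mem_ball] at hy hy'
    have h1 := hsep i j hij
    have h2 := dist_triangle4 (x i) (TopologicalSpace.denseSeq (EuclideanSpace ℝ (Fin d)) (q i)) y
      (x j)
    have h3 := dist_triangle y (TopologicalSpace.denseSeq (EuclideanSpace ℝ (Fin d)) (q j)) (x j)
    have h4 := hq i
    have h5 := hq j
    rw [dist_comm] at h5
    rw [dist_comm] at hy
    linarith

theorem measurableSet_ballBox (p : ℕ × (ι → ℕ)) :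
    MeasurableSet (Set.univ.pi (ballBox d ι p)) :=
  MeasurableSet.univ_pi fun _ => Metric.isOpen_ball.measurableSet

/-- The factorial measure of a disjoint rectangle intersected with any rectangle. -/
theorem factorialMeasure_restrict_pi (ξ : PointConfig d) (p : DisjointBox d ι)
    {s : ι → Set (EuclideanSpace ℝ (Fin d))} (hs : ∀ i, MeasurableSet (s i)) :
    (factorialMeasure ι ξ).restrict (Set.univ.pi (ballBox d ι p.1)) (Set.univ.pi s)
      = ∏ i, ((ξ.count (s i ∩ ballBox d ι p.1 i) : ℕ∞) : ℝ≥0∞) := by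
  rw [Measure.restrict_apply (MeasurableSet.univ_pi hs), ← Set.pi_inter_distrib,
    factorialMeasure_pi ξ (A := fun i => s i ∩ ballBox d ι p.1 i)
      (fun i => (hs i).inter Metric.isOpen_ball.measurableSet)
      (fun i => Metric.isBounded_ball.subset Set.inter_subset_right)
      (fun i j hij => (p.2 hij).mono Set.inter_subset_right Set.inter_subset_right)]

/-- The factorial measure depends measurably on the configuration. On a rectangle with disjoint
bounded sides this can be tested on subrectangles, where the measure is a product of counts. -/
theorem measurable_factorialMeasure : Measurable (factorialMeasure (d := d) ι) := by
  classical
  have hbox : ∀ p : DisjointBox d ι, Measurable fun ξ : PointConfig d =>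
      (factorialMeasure ι ξ).restrict (Set.univ.pi (ballBox d ι p.1)) := by
    intro p
    have hmeas : ∀ s : ι → Set (EuclideanSpace ℝ (Fin d)), (∀ i, MeasurableSet (s i)) →
        Measurable fun ξ : PointConfig d =>
          (factorialMeasure ι ξ).restrict (Set.univ.pi (ballBox d ι p.1)) (Set.univ.pi s) := by
      intro s hs
      simp_rw [factorialMeasure_restrict_pi _ p hs]
      refine Finset.measurable_prod _ fun i _ => ?_
      exact (measurable_from_top (f := fun n : ℕ∞ => (n : ℝ≥0∞))).comp
        (PointConfig.measurable_count ((hs i).inter Metric.isOpen_ball.measurableSet))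
    have hfin : ∀ ξ : PointConfig d, IsFiniteMeasure
        ((factorialMeasure ι ξ).restrict (Set.univ.pi (ballBox d ι p.1))) := fun ξ => by
      refine ⟨?_⟩
      rw [← Set.pi_univ Set.univ, factorialMeasure_restrict_pi ξ p fun _ => MeasurableSet.univ]
      refine ENNReal.prod_lt_top fun i _ => ?_
      have hb : Bornology.IsBounded (Set.univ ∩ ballBox d ι p.1 i) :=
        Metric.isBounded_ball.subset Set.inter_subset_right
      rw [PointConfig.count, (ξ.finite_inter hb).encard_eq_coe_toFinset_card]
      exact ENNReal.natCast_lt_top _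
    refine Measurable.measure_of_isPiSystem generateFrom_pi.symm isPiSystem_pi ?_ ?_
    · rintro _ ⟨s, hs, rfl⟩
      exact hmeas s fun i => hs i (Set.mem_univ i)
    · have := hmeas (fun _ => Set.univ) fun _ => MeasurableSet.univ
      rwa [Set.pi_univ] at this
  -- the rectangles cover all injective tuples; make the cover disjoint
  refine Measure.measurable_of_measurable_coe _ fun A hA => ?_
  obtain ⟨e, he⟩ : ∃ e : ℕ → Set (ι → EuclideanSpace ℝ (Fin d)), (∀ n, MeasurableSet (e n)) ∧
      (⋃ n, e n = {x | Function.Injective x}) ∧ ∀ n, Measurable fun ξ : PointConfig d =>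
        (factorialMeasure ι ξ).restrict (e n) := by
    rcases isEmpty_or_nonempty (DisjointBox d ι) with hemp | hne
    · refine ⟨fun _ => ∅, fun _ => MeasurableSet.empty, ?_, fun n => by simp⟩
      rw [← iUnion_disjointBox]
      simp
    · obtain ⟨u, hu⟩ := exists_surjective_nat (DisjointBox d ι)
      refine ⟨fun n => Set.univ.pi (ballBox d ι (u n).1), fun n => measurableSet_ballBox _, ?_,
        fun n => hbox _⟩
      rw [← iUnion_disjointBox, hu.iUnion_comp fun p => Set.univ.pi (ballBox d ι p.1)]
  obtain ⟨hem, hecov, herest⟩ := he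
  have hsum : ∀ ξ : PointConfig d, factorialMeasure ι ξ A
      = ∑' n, (factorialMeasure ι ξ).restrict (e n) (A ∩ disjointed e n) := by
    intro ξ
    have h1 : factorialMeasure ι ξ A = factorialMeasure ι ξ (⋃ n, A ∩ disjointed e n) := by
      rw [← Set.inter_iUnion, iUnion_disjointed, hecov, factorialMeasure,
        Measure.restrict_apply hA, Measure.restrict_apply]
      · congr 1
        ext x
        simp only [distinctTuples, Set.mem_inter_iff, Set.mem_ofPred_eq]
        tauto
      · rw [← hecov]
        exact hA.inter (MeasurableSet.iUnion hem)
    rw [h1, measure_iUnion]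
    · refine tsum_congr fun n => ?_
      rw [Measure.restrict_apply (hA.inter (MeasurableSet.disjointed hem n)),
        Set.inter_assoc, Set.inter_eq_left.2 (disjointed_subset e n)]
    · exact fun i j hij => (disjoint_disjointed e hij).mono Set.inter_subset_right
        Set.inter_subset_right
    · exact fun n => hA.inter (MeasurableSet.disjointed hem n)
  simp_rw [hsum]
  exact Measurable.tsum fun n => (Measure.measurable_coe
    (hA.inter (MeasurableSet.disjointed hem n))).comp (herest n)

/-- The mean of the Poisson distribution. -/
theorem lintegral_poissonMeasure_id (r : ℝ≥0) : ∫⁻ n : ℕ, (n : ℝ≥0∞) ∂(poissonMeasure r) = r := by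
  have h1 : ∫⁻ n : ℕ, (n : ℝ≥0∞) ∂(poissonMeasure r)
      = ∑' n : ℕ, ENNReal.ofReal (n * (Real.exp (-r) * r ^ n / n !)) := by
    rw [lintegral_countable']
    refine tsum_congr fun n => ?_
    rw [poissonMeasure_singleton, ENNReal.ofReal_mul (Nat.cast_nonneg n), ENNReal.ofReal_natCast]
  have h2 : HasSum (fun n : ℕ => (n : ℝ) * (Real.exp (-r) * r ^ n / n !)) r := by
    rw [← hasSum_nat_add_iff' 1]
    simp only [Finset.range_one, Finset.sum_singleton, Nat.cast_zero, zero_mul, sub_zero]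
    have h3 := (hasSum_one_poissonMeasure r).mul_left (r : ℝ)
    rw [mul_one] at h3
    refine (congrArg (fun g : ℕ → ℝ => HasSum g (r : ℝ)) (funext fun n => ?_)).mpr h3
    rw [Nat.factorial_succ]
    push_cast
    field_simp
    ring
  rw [h1, ← ENNReal.ofReal_tsum_of_nonneg (fun n => by positivity) h2.summable, h2.tsum_eq,
    ENNReal.ofReal_coe_nnreal]

variable {Ω : Type*} [MeasurableSpace Ω] {P : Measure Ω}
  {ν : Measure (EuclideanSpace ℝ (Fin d))} {η : Ω → PointConfig d}

theorem IsPoissonProcess.lintegral_count (hη : IsPoissonProcess P ν η)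
    {A : Set (EuclideanSpace ℝ (Fin d))} (hA : MeasurableSet A) (hfin : ν A ≠ ∞) :
    ∫⁻ ω, ((((η ω).count A : ℕ∞)) : ℝ≥0∞) ∂P = ν A := by
  have hm : Measurable fun n : ℕ∞ => (n : ℝ≥0∞) := measurable_from_top
  rw [← lintegral_map (f := fun n : ℕ∞ => (n : ℝ≥0∞)) (g := fun ω => (η ω).count A) hm
    ((PointConfig.measurable_count hA).comp hη.measurable), hη.map_count A hA hfin,
    lintegral_map hm measurable_from_top]
  simp only [ENat.toENNReal_coe]
  rw [lintegral_poissonMeasure_id, ENNReal.coe_toNNReal hfin]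

/-- The diagonals are null sets for powers of a diffuse measure. -/
theorem ae_injective_pi [SigmaFinite ν] [NullSingletonClass ν] :
    ∀ᵐ x ∂(Measure.pi fun _ : ι => ν), Function.Injective x := by
  classical
  have h : ∀ i j : ι, i ≠ j → ∀ᵐ x ∂(Measure.pi fun _ : ι => ν), x i ≠ x j := by
    intro i j hij
    have hmeas : MeasurableSet {x : ι → EuclideanSpace ℝ (Fin d) | x i = x j} :=
      measurableSet_eq_fun (measurable_pi_apply i) (measurable_pi_apply j)
    have hmp := (measurePreserving_piEquivPiSubtypeProd (fun _ : ι => ν) fun l => l ≠ i).symm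
    rw [ae_iff]
    simp only [ne_eq, not_not]
    rw [← hmp.measure_preimage_equiv, Measure.measure_prod_null
      ((MeasurableEquiv.measurable _) hmeas)]
    refine ae_of_all _ fun b => ?_
    have h0 := Measure.pi_hyperplane (fun _ : {l // ¬ l ≠ i} => ν) ⟨i, by simp⟩ (b ⟨j, hij.symm⟩)
    refine Eq.trans (congrArg _ ?_) h0
    ext a
    simp [MeasurableEquiv.piEquivPiSubtypeProd, Equiv.piEquivPiSubtypeProd, hij.symm]
  have h' : ∀ᵐ x ∂(Measure.pi fun _ : ι => ν), ∀ i j : ι, i ≠ j → x i ≠ x j := by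
    rw [ae_all_iff]; intro i; rw [ae_all_iff]; intro j
    by_cases hij : i = j
    · simp [hij]
    · filter_upwards [h i j hij] with x hx _ using hx
  filter_upwards [h'] with x hx i j hij
  by_contra hne
  exact hx i j hne hij

/-- The factorial moment measures of a Poisson process with diffuse, locally finite intensity
measure are the powers of the intensity measure. Both measures live on the injective tuples, which
are covered by countably many rectangles with pairwise disjoint bounded sides; there the counts of
the sides are independent and have the right means. -/
theorem IsPoissonProcess.bind_factorialMeasure (hη : IsPoissonProcess P ν η)
    [SigmaFinite ν] [NullSingletonClass ν]
    (hfin : ∀ A, Bornology.IsBounded A → ν A < ∞) :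
    P.bind (fun ω => factorialMeasure ι (η ω)) = Measure.pi fun _ : ι => ν := by
  classical
  have hκ : Measurable fun ω => factorialMeasure ι (η ω) :=
    measurable_factorialMeasure.comp hη.measurable
  have hinj : MeasurableSet {x : ι → EuclideanSpace ℝ (Fin d) | Function.Injective x} := by
    rw [← iUnion_disjointBox]
    exact MeasurableSet.iUnion fun p => measurableSet_ballBox _
  have hbox : ∀ p : DisjointBox d ι,
      (P.bind fun ω => factorialMeasure ι (η ω)).restrict (Set.univ.pi (ballBox d ι p.1))
        = (Measure.pi fun _ : ι => ν).restrict (Set.univ.pi (ballBox d ι p.1)) := by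
    intro p
    rw [Measure.restrict_pi_pi]
    refine (Measure.pi_eq fun s hs => ?_).symm
    have hsm : ∀ i, MeasurableSet (s i ∩ ballBox d ι p.1 i) :=
      fun i => (hs i).inter Metric.isOpen_ball.measurableSet
    rw [Measure.restrict_apply (MeasurableSet.univ_pi hs), Measure.bind_apply
      ((MeasurableSet.univ_pi hs).inter (measurableSet_ballBox _)) hκ.aemeasurable]
    have h1 : ∀ ω, factorialMeasure ι (η ω) (Set.univ.pi s ∩ Set.univ.pi (ballBox d ι p.1))
        = ∏ i, (((η ω).count (s i ∩ ballBox d ι p.1 i) : ℕ∞) : ℝ≥0∞) := fun ω => by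
      rw [← factorialMeasure_restrict_pi (η ω) p hs,
        Measure.restrict_apply (MeasurableSet.univ_pi hs)]
    simp_rw [h1]
    have hm : Measurable fun n : ℕ∞ => (n : ℝ≥0∞) := measurable_from_top
    have hindep : iIndepFun (fun (i : ι) ω =>
        (((η ω).count (s i ∩ ballBox d ι p.1 i) : ℕ∞) : ℝ≥0∞)) P := by
      have e := Fintype.equivFin ι
      have h2 := hη.indep_count _ (fun j => s (e.symm j) ∩ ballBox d ι p.1 (e.symm j))
        (fun j => hsm _) (fun i j hij => (p.2 (e.symm.injective.ne hij)).mono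
          Set.inter_subset_right Set.inter_subset_right)
      have h3 := (h2.comp (fun _ n => (n : ℝ≥0∞)) fun _ => hm).precomp e.injective
      simpa [Function.comp_def] using h3
    rw [lintegral_prod_eq_prod_lintegral_of_indepFun _ _ hindep fun i =>
      hm.comp ((PointConfig.measurable_count (hsm i)).comp hη.measurable)]
    refine Finset.prod_congr rfl fun i _ => ?_
    rw [hη.lintegral_count (hsm i)
      (hfin _ (Metric.isBounded_ball.subset Set.inter_subset_right)).ne,
      Measure.restrict_apply (hs i)]
  have hres := (Measure.restrict_iUnion_congr (s := fun p : DisjointBox d ι =>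
    Set.univ.pi (ballBox d ι p.1))).2 hbox
  rw [iUnion_disjointBox] at hres
  have h1 : (P.bind fun ω => factorialMeasure ι (η ω)).restrict {x | Function.Injective x}
      = P.bind fun ω => factorialMeasure ι (η ω) := by
    refine Measure.restrict_eq_self_of_ae_mem ?_
    change (P.bind fun ω => factorialMeasure ι (η ω)) {x | Function.Injective x}ᶜ = 0
    rw [Measure.bind_apply hinj.compl hκ.aemeasurable]
    refine lintegral_eq_zero_of_ae_eq_zero (ae_of_all _ fun ω => ?_)
    change Measure.count.restrict (distinctTuples ι (η ω)) _ = 0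
    rw [Measure.restrict_apply hinj.compl]
    convert measure_empty (μ := Measure.count)
    ext x
    simp +contextual [distinctTuples]
  rw [← h1, hres]
  exact Measure.restrict_eq_self_of_ae_mem (s := {x | Function.Injective x}) ae_injective_pi

/-- The multivariate Campbell formula. -/
theorem IsPoissonProcess.lintegral_factorialMeasure (hη : IsPoissonProcess P ν η)
    [SigmaFinite ν] [NullSingletonClass ν] (hfin : ∀ A, Bornology.IsBounded A → ν A < ∞)
    {f : (ι → EuclideanSpace ℝ (Fin d)) → ℝ≥0∞} (hf : Measurable f) :
    ∫⁻ ω, ∫⁻ x, f x ∂(factorialMeasure ι (η ω)) ∂P = ∫⁻ x, f x ∂(Measure.pi fun _ : ι => ν) := by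
  have hκ : Measurable fun ω => factorialMeasure ι (η ω) :=
    measurable_factorialMeasure.comp hη.measurable
  rw [← hη.bind_factorialMeasure hfin, Measure.lintegral_bind hκ.aemeasurable hf.aemeasurable]

end FactorialMoments

/-! ### Products of U-statistics -/

section Patterns

variable {d : ℕ} {A B : Type}

/-- A coincidence pattern of two tuples of pairwise distinct points indexed by `A` and `B`: the
equivalence relation on `A ⊕ B` that says which indices carry the same point. Within each of the
two tuples distinct indices are inequivalent. -/
abbrev PairPattern (A B : Type) : Type :=
  {s : Setoid (A ⊕ B) // (∀ i j, s (.inl i) (.inl j) → i = j) ∧ ∀ i j, s (.inr i) (.inr j) → i = j}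

/-- The index set of the distinct points in the union of two tuples with coincidence pattern `s`. -/
def PairPattern.Index (s : PairPattern A B) : Type := Quotient s.1

/-- The point of the union that the index `a` carries. -/
def PairPattern.mk (s : PairPattern A B) (a : A ⊕ B) : s.Index := Quotient.mk s.1 a

theorem PairPattern.mk_eq_mk (s : PairPattern A B) {a b : A ⊕ B} : s.mk a = s.mk b ↔ s.1 a b :=
  Quotient.eq

theorem PairPattern.mk_surjective (s : PairPattern A B) : Function.Surjective s.mk :=
  Quotient.mk_surjective

theorem PairPattern.mk_inl_injective (s : PairPattern A B) :
    Function.Injective fun i => s.mk (.inl i) :=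
  fun i j h => s.2.1 i j (s.mk_eq_mk.1 h)

theorem PairPattern.mk_inr_injective (s : PairPattern A B) :
    Function.Injective fun i => s.mk (.inr i) :=
  fun i j h => s.2.2 i j (s.mk_eq_mk.1 h)

instance PairPattern.finite_index [Finite A] [Finite B] (s : PairPattern A B) : Finite s.Index :=
  Finite.of_surjective s.mk s.mk_surjective

noncomputable instance PairPattern.fintypeIndex [Finite A] [Finite B] (s : PairPattern A B) :
    Fintype s.Index :=
  Fintype.ofFinite _

instance PairPattern.finite [Finite A] [Finite B] : Finite (PairPattern A B) := by
  have : Finite (Setoid (A ⊕ B)) :=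
    Finite.of_injective (fun s : Setoid (A ⊕ B) => fun a b => s a b) fun s t h =>
      Setoid.ext fun a b => by exact iff_of_eq (congrFun (congrFun h a) b)
  infer_instance

noncomputable instance PairPattern.fintype [Finite A] [Finite B] : Fintype (PairPattern A B) :=
  Fintype.ofFinite _

/-- The pattern of two tuples without common points. -/
def PairPattern.disjoint (A B : Type) : PairPattern A B :=
  ⟨⊥, fun _ _ h => Sum.inl_injective h, fun _ _ h => Sum.inr_injective h⟩

/-- A tuple of distinct points indexed by the classes of a pattern, seen as a pair of tuples. -/
def PairPattern.toPair (ξ : PointConfig d)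
    (p : Σ s : PairPattern A B, distinctTuples s.Index ξ) :
    distinctTuples A ξ × distinctTuples B ξ :=
  (⟨fun i => p.2.1 (p.1.mk (.inl i)), p.2.2.1.comp p.1.mk_inl_injective, fun _ => p.2.2.2 _⟩,
    ⟨fun i => p.2.1 (p.1.mk (.inr i)), p.2.2.1.comp p.1.mk_inr_injective, fun _ => p.2.2.2 _⟩)

theorem PairPattern.toPair_elim (ξ : PointConfig d)
    (p : Σ s : PairPattern A B, distinctTuples s.Index ξ) (a : A ⊕ B) :
    Sum.elim (PairPattern.toPair ξ p).1.1 (PairPattern.toPair ξ p).2.1 a = p.2.1 (p.1.mk a) := by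
  cases a <;> rfl

theorem PairPattern.toPair_bijective (ξ : PointConfig d) :
    Function.Bijective (PairPattern.toPair (A := A) (B := B) ξ) := by
  constructor
  · intro p q h
    have hpq : ∀ a, p.2.1 (p.1.mk a) = q.2.1 (q.1.mk a) := fun a => by
      rw [← PairPattern.toPair_elim, ← PairPattern.toPair_elim, h]
    obtain ⟨s, w⟩ := p
    obtain ⟨t, v⟩ := q
    obtain rfl : s = t := by
      refine Subtype.ext (Setoid.ext fun a b => ?_)
      rw [← s.mk_eq_mk, ← t.mk_eq_mk, ← w.2.1.eq_iff, ← v.2.1.eq_iff]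
      simp only at hpq
      rw [hpq, hpq]
    obtain rfl : w = v := by
      refine Subtype.ext (funext fun q => ?_)
      obtain ⟨a, rfl⟩ := s.mk_surjective q
      exact hpq a
    rfl
  · rintro ⟨x, y⟩
    let z : A ⊕ B → EuclideanSpace ℝ (Fin d) := Sum.elim x.1 y.1
    let s : PairPattern A B := ⟨Setoid.ker z, fun i j h => x.2.1 h, fun i j h => y.2.1 h⟩
    let w : s.Index → EuclideanSpace ℝ (Fin d) := Quotient.lift z fun a b h => h
    have hw : ∀ a, w (s.mk a) = z a := fun a => rfl
    refine ⟨⟨s, w, ?_, ?_⟩, ?_⟩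
    · intro p q h
      obtain ⟨a, rfl⟩ := s.mk_surjective p
      obtain ⟨b, rfl⟩ := s.mk_surjective q
      exact s.mk_eq_mk.2 h
    · intro p
      obtain ⟨a, rfl⟩ := s.mk_surjective p
      rw [hw]
      cases a with
      | inl i => exact x.2.2 i
      | inr i => exact y.2.2 i
    · rfl

/-- The contribution of a coincidence pattern to the product of the kernels `f` and `g`. -/
noncomputable def PairPattern.kernel (s : PairPattern A B)
    (f : (A → EuclideanSpace ℝ (Fin d)) → ℝ≥0∞) (g : (B → EuclideanSpace ℝ (Fin d)) → ℝ≥0∞)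
    (w : s.Index → EuclideanSpace ℝ (Fin d)) : ℝ≥0∞ :=
  f (fun i => w (s.mk (.inl i))) * g (fun i => w (s.mk (.inr i)))

theorem PairPattern.measurable_kernel (s : PairPattern A B)
    {f : (A → EuclideanSpace ℝ (Fin d)) → ℝ≥0∞} {g : (B → EuclideanSpace ℝ (Fin d)) → ℝ≥0∞}
    (hf : Measurable f) (hg : Measurable g) : Measurable (s.kernel f g) :=
  Measurable.mul
    (hf.comp (f := fun (w : s.Index → EuclideanSpace ℝ (Fin d)) i => w (s.mk (.inl i)))
      (by fun_prop))
    (hg.comp (f := fun (w : s.Index → EuclideanSpace ℝ (Fin d)) i => w (s.mk (.inr i)))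
      (by fun_prop))

/-- The product of two U-statistics is the sum over the coincidence patterns of U-statistics whose
order is the number of distinct points. -/
theorem lintegral_factorialMeasure_mul [Fintype A] [Fintype B]
    (f : (A → EuclideanSpace ℝ (Fin d)) → ℝ≥0∞) (g : (B → EuclideanSpace ℝ (Fin d)) → ℝ≥0∞)
    (ξ : PointConfig d) :
    (∫⁻ x, f x ∂(factorialMeasure A ξ)) * ∫⁻ y, g y ∂(factorialMeasure B ξ)
      = ∑ s : PairPattern A B, ∫⁻ w, s.kernel f g w ∂(factorialMeasure s.Index ξ) := by
  simp_rw [lintegral_factorialMeasure]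
  rw [← tsum_fintype (L := .unconditional _), ← ENNReal.tsum_mul_right]
  simp_rw [← ENNReal.tsum_mul_left]
  rw [← ENNReal.tsum_prod (f := fun (x : distinctTuples A ξ) (y : distinctTuples B ξ) =>
    f x * g y), ← ENNReal.tsum_sigma (fun (s : PairPattern A B) (w : distinctTuples s.Index ξ) =>
      s.kernel f g w)]
  exact ((Equiv.ofBijective _ (PairPattern.toPair_bijective ξ)).tsum_eq
    (fun p : distinctTuples A ξ × distinctTuples B ξ => f p.1 * g p.2)).symm

/-- Renaming the indices in an integral against a power of a measure. -/
theorem lintegral_pi_reindex {X : Type*} [MeasurableSpace X] {ι κ : Type} [Fintype ι] [Fintype κ]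
    (ν : Measure X) [SigmaFinite ν] (e : ι ≃ κ) (f : (ι → X) → ℝ≥0∞) :
    ∫⁻ x, f x ∂(Measure.pi fun _ : ι => ν)
      = ∫⁻ y, f (fun i => y (e i)) ∂(Measure.pi fun _ : κ => ν) := by
  have h := (measurePreserving_piCongrLeft (fun _ : κ => ν) e).symm
  rw [← h.lintegral_comp_emb (MeasurableEquiv.measurableEmbedding _)]
  rfl

/-- Without coincidences the two factors involve disjoint groups of variables. -/
theorem PairPattern.lintegral_kernel_disjoint [Fintype A] [Fintype B]
    (ν : Measure (EuclideanSpace ℝ (Fin d))) [SigmaFinite ν]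
    {f : (A → EuclideanSpace ℝ (Fin d)) → ℝ≥0∞} {g : (B → EuclideanSpace ℝ (Fin d)) → ℝ≥0∞}
    (hf : Measurable f) (hg : Measurable g) :
    ∫⁻ w, (PairPattern.disjoint A B).kernel f g w ∂(Measure.pi fun _ => ν)
      = (∫⁻ x, f x ∂(Measure.pi fun _ => ν)) * ∫⁻ y, g y ∂(Measure.pi fun _ => ν) := by
  have hbij : Function.Bijective (PairPattern.disjoint A B).mk :=
    ⟨fun a b h => (PairPattern.mk_eq_mk _).1 h, PairPattern.mk_surjective _⟩
  have hmp := measurePreserving_sumPiEquivProdPi_symm (fun _ : A ⊕ B => ν)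
  rw [lintegral_pi_reindex ν (Equiv.ofBijective _ hbij).symm,
    ← hmp.lintegral_comp_emb (MeasurableEquiv.measurableEmbedding _),
    ← lintegral_prod_mul hf.aemeasurable hg.aemeasurable]
  refine lintegral_congr fun p => ?_
  have h : ∀ a, (Equiv.ofBijective _ hbij).symm ((PairPattern.disjoint A B).mk a) = a :=
    fun a => (Equiv.ofBijective _ hbij).symm_apply_apply a
  simp only [PairPattern.kernel, h]
  rfl

variable {Ω : Type*} [MeasurableSpace Ω] {P : Measure Ω}
  {ν : Measure (EuclideanSpace ℝ (Fin d))} {η : Ω → PointConfig d}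

theorem IsPoissonProcess.measurable_lintegral_factorialMeasure (hη : IsPoissonProcess P ν η)
    [Fintype A] {f : (A → EuclideanSpace ℝ (Fin d)) → ℝ≥0∞} (hf : Measurable f) :
    Measurable fun ω => ∫⁻ x, f x ∂(factorialMeasure A (η ω)) :=
  (Measure.measurable_lintegral hf).comp (measurable_factorialMeasure.comp hη.measurable)

open Classical in
/-- The second moment of a U-statistic: the pattern without coincidences gives the square of the
mean, so the variance is the sum over the remaining patterns. -/
theorem IsPoissonProcess.lintegral_sq (hη : IsPoissonProcess P ν η)
    [SigmaFinite ν] [NullSingletonClass ν] (hfin : ∀ A, Bornology.IsBounded A → ν A < ∞)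
    [Fintype A] {f : (A → EuclideanSpace ℝ (Fin d)) → ℝ≥0∞} (hf : Measurable f) :
    ∫⁻ ω, (∫⁻ x, f x ∂(factorialMeasure A (η ω))) ^ 2 ∂P
      = (∫⁻ x, f x ∂(Measure.pi fun _ : A => ν)) ^ 2
        + ∑ s ∈ Finset.univ.filter (fun s => s ≠ PairPattern.disjoint A A),
          ∫⁻ w, s.kernel f f w ∂(Measure.pi fun _ => ν) := by
  simp_rw [sq, lintegral_factorialMeasure_mul]
  rw [lintegral_finsetSum _ fun s _ =>
    hη.measurable_lintegral_factorialMeasure (s.measurable_kernel hf hf)]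
  simp_rw [hη.lintegral_factorialMeasure hfin (PairPattern.measurable_kernel _ hf hf)]
  rw [← PairPattern.lintegral_kernel_disjoint ν hf hf, Finset.filter_ne']
  exact (Finset.add_sum_erase _ (fun s : PairPattern A A =>
    ∫⁻ w, s.kernel f f w ∂(Measure.pi fun _ => ν)) (Finset.mem_univ _)).symm

end Patterns

/-! ### The subgraph kernel -/

section Kernel

variable {d k : ℕ}

/-- The geometric graph of a labelled tuple of points, carried over to the set of labels. -/
def labelGraph (S : Set (EuclideanSpace ℝ (Fin d))) (x : Fin k → EuclideanSpace ℝ (Fin d)) :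
    SimpleGraph (Fin k) :=
  SimpleGraph.fromRel fun i j => x i - x j ∈ S

/-- The number of copies of `H` in a graph on `k` labels, divided by `k!`. -/
noncomputable def copyWeight (H G : SimpleGraph (Fin k)) : ℝ≥0∞ :=
  (G.copyCount H : ℝ≥0∞) / (k ! : ℝ≥0∞)

/-- Isomorphic graphs have equally many subgraphs isomorphic to `H`. -/
theorem card_subgraph_iso_congr {V W U : Type*} {G : SimpleGraph V} {G' : SimpleGraph W}
    (H : SimpleGraph U) (e : G ≃g G') :
    Nat.card {H' : G.Subgraph // Nonempty (H'.coe ≃g H)}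
      = Nat.card {H' : G'.Subgraph // Nonempty (H'.coe ≃g H)} := by
  have hid : e.symm.toHom.comp e.toHom = SimpleGraph.Hom.id := by ext v; simp
  have hid' : e.toHom.comp e.symm.toHom = SimpleGraph.Hom.id := by ext v; simp
  let F : G.Subgraph ≃ G'.Subgraph :=
    { toFun := SimpleGraph.Subgraph.map e.toHom
      invFun := SimpleGraph.Subgraph.map e.symm.toHom
      left_inv := fun H' => by
        rw [← SimpleGraph.Subgraph.map_comp, hid, SimpleGraph.Subgraph.map_id]
      right_inv := fun H' => by
        rw [← SimpleGraph.Subgraph.map_comp, hid', SimpleGraph.Subgraph.map_id] }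
  refine Nat.card_congr (F.subtypeEquiv fun H' => ?_)
  have i : H'.coe ≃g (F H').coe := e.toCopy.isoSubgraphMap H'
  exact ⟨fun ⟨j⟩ => ⟨i.symm.trans j⟩, fun ⟨j⟩ => ⟨i.trans j⟩⟩

/-- Distinctness matters here: a tuple with repetitions spans fewer than `k` vertices, while its
labelled graph always has `k`. -/
theorem subgraphKernel_eq_copyWeight (H : SimpleGraph (Fin k))
    (S : Set (EuclideanSpace ℝ (Fin d))) {x : Fin k → EuclideanSpace ℝ (Fin d)}
    (hx : Function.Injective x) :
    subgraphKernel H S x = copyWeight H (labelGraph S x) := by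
  classical
  let e : labelGraph S x ≃g geomGraph S (Set.range x) :=
    { toEquiv := Equiv.ofInjective x hx
      map_rel_iff' := by
        intro a b
        have h : (⟨x a, Set.mem_range_self a⟩ : Set.range x) = ⟨x b, Set.mem_range_self b⟩
            ↔ a = b := by
          rw [Subtype.mk.injEq, hx.eq_iff]
        simp only [labelGraph, geomGraph, Equiv.ofInjective_apply, SimpleGraph.fromRel_adj, ne_eq,
          h] }
  rw [subgraphKernel, copyWeight, ← card_subgraph_iso_congr H e]
  congr 2
  rw [SimpleGraph.copyCount, Nat.card_eq_fintype_card, Fintype.card_subtype]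
  congr 1
  ext H'
  simp only [Finset.mem_filter, Finset.mem_univ, true_and]
  exact ⟨fun ⟨j⟩ => ⟨j.symm⟩, fun ⟨j⟩ => ⟨j.symm⟩⟩

/-- The subgraph count only involves tuples of distinct points, on which the kernel is a function of
the labelled graph. -/
theorem subgraphCount_eq_lintegral (H : SimpleGraph (Fin k)) (S : Set (EuclideanSpace ℝ (Fin d)))
    (ξ : PointConfig d) :
    subgraphCount H S ξ = ∫⁻ x, copyWeight H (labelGraph S x) ∂(factorialMeasure (Fin k) ξ) := by
  rw [lintegral_factorialMeasure]
  exact tsum_congr fun x => subgraphKernel_eq_copyWeight H S x.2.1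

theorem measurable_copyWeight_labelGraph (H : SimpleGraph (Fin k))
    {S : Set (EuclideanSpace ℝ (Fin d))} (hS : MeasurableSet S) :
    Measurable fun x : Fin k → EuclideanSpace ℝ (Fin d) => copyWeight H (labelGraph S x) := by
  classical
  -- the graph takes finitely many values, and each is taken on a measurable set
  have hind : ∀ x : Fin k → EuclideanSpace ℝ (Fin d), copyWeight H (labelGraph S x)
      = ∑ G : SimpleGraph (Fin k),
        Set.indicator {x | labelGraph S x = G} (fun _ => copyWeight H G) x := by
    intro x
    rw [Finset.sum_eq_single (labelGraph S x)]
    · simp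
    · intro G _ hG
      simp [hG.symm]
    · simp
  simp_rw [hind]
  refine Finset.measurable_sum _ fun G _ => measurable_const.indicator ?_
  have hset : {x : Fin k → EuclideanSpace ℝ (Fin d) | labelGraph S x = G}
      = ⋂ i, ⋂ j, {x | (labelGraph S x).Adj i j ↔ G.Adj i j} := by
    ext x
    simp only [Set.mem_ofPred_eq, Set.mem_iInter]
    exact ⟨fun h i j => h ▸ Iff.rfl, fun h => by ext i j; exact h i j⟩
  rw [hset]
  refine MeasurableSet.iInter fun i => MeasurableSet.iInter fun j => ?_
  have hsub : ∀ i j : Fin k,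
      MeasurableSet {x : Fin k → EuclideanSpace ℝ (Fin d) | x i - x j ∈ S} := fun i j =>
    ((measurable_pi_apply i).sub (measurable_pi_apply j)) hS
  have hadj : MeasurableSet {x : Fin k → EuclideanSpace ℝ (Fin d) | (labelGraph S x).Adj i j} :=
    (MeasurableSet.const _).inter ((hsub i j).union (hsub j i))
  by_cases hG : G.Adj i j
  · simpa [hG] using hadj
  · have h := hadj.compl
    rw [Set.compl_ofPred] at h
    simpa only [hG, iff_false] using h

/-- Rescaling and translating the points amounts to rescaling the set of edge vectors. -/
theorem labelGraph_smul (S : Set (EuclideanSpace ℝ (Fin d))) {r : ℝ} (hr : r ≠ 0)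
    (x : Fin k → EuclideanSpace ℝ (Fin d)) (v : EuclideanSpace ℝ (Fin d)) :
    labelGraph (r • S) (fun i => v + r • x i) = labelGraph S x := by
  ext i j
  simp [labelGraph, add_sub_add_left_eq_sub, ← smul_sub, Set.smul_mem_smul_set_iff₀ hr]

theorem exists_copyWeight_le (H : SimpleGraph (Fin k)) :
    ∃ C : ℝ≥0, ∀ G : SimpleGraph (Fin k), copyWeight H G ≤ C := by
  have hfin : ∀ G : SimpleGraph (Fin k), copyWeight H G ≠ ∞ := fun G =>
    ENNReal.div_ne_top (ENNReal.natCast_ne_top _) (Nat.cast_ne_zero.2 (Nat.factorial_ne_zero k))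
  refine ⟨∑ G, (copyWeight H G).toNNReal, fun G => ?_⟩
  rw [← ENNReal.coe_toNNReal (hfin G), ENNReal.coe_le_coe]
  exact Finset.single_le_sum (f := fun G => (copyWeight H G).toNNReal) (fun _ _ => zero_le)
    (Finset.mem_univ G)

theorem copyWeight_top_pos (H : SimpleGraph (Fin k)) : 0 < copyWeight H ⊤ := by
  refine ENNReal.div_pos ?_ (ENNReal.natCast_ne_top _)
  have h : H.IsContained (⊤ : SimpleGraph (Fin k)) := .of_le le_top
  exact Nat.cast_ne_zero.2 (SimpleGraph.copyCount_pos.2 h).ne'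

theorem labelGraph_eq_top {S : Set (EuclideanSpace ℝ (Fin d))}
    (hS : Metric.closedBall 0 1 ⊆ S) {x : Fin k → EuclideanSpace ℝ (Fin d)}
    (hx : ∀ i j, ‖x i - x j‖ ≤ 1) : labelGraph S x = ⊤ := by
  ext i j
  simp only [labelGraph, SimpleGraph.fromRel_adj, SimpleGraph.top_adj, and_iff_left_iff_imp]
  exact fun _ => Or.inl (hS (by simpa using hx i j))

theorem norm_sub_le_of_walk {S : Set (EuclideanSpace ℝ (Fin d))} {θ : ℝ}
    (hS : S ⊆ Metric.closedBall 0 θ) {x : Fin k → EuclideanSpace ℝ (Fin d)} {i j : Fin k}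
    (p : (labelGraph S x).Walk i j) : ‖x i - x j‖ ≤ p.length * θ := by
  induction p with
  | nil => simp
  | @cons a b c h p ih =>
    have hab : ‖x a - x b‖ ≤ θ := by
      rw [labelGraph, SimpleGraph.fromRel_adj] at h
      rcases h.2 with h | h
      · simpa using hS h
      · rw [norm_sub_rev]
        simpa using hS h
    have h3 := norm_sub_le_norm_sub_add_norm_sub (x a) (x b) (x c)
    rw [SimpleGraph.Walk.length_cons]
    push_cast
    linarith

/-- If the tuple carries a copy of `H`, its points are within distance `diam H · θ` of each
other: a copy of `H` uses all labels, and its paths have at most `diam H` edges. -/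
theorem norm_sub_le_of_copyWeight_ne_zero {H : SimpleGraph (Fin k)} (hH : H.Connected)
    {S : Set (EuclideanSpace ℝ (Fin d))} {θ : ℝ} (hθ : 0 ≤ θ) (hS : S ⊆ Metric.closedBall 0 θ)
    {x : Fin k → EuclideanSpace ℝ (Fin d)} (hx : copyWeight H (labelGraph S x) ≠ 0) (i j : Fin k) :
    ‖x i - x j‖ ≤ H.diam * θ := by
  have hpos : H.IsContained (labelGraph S x) := by
    rw [← SimpleGraph.copyCount_pos, Nat.pos_iff_ne_zero]
    intro h
    exact hx (by simp [copyWeight, h])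
  obtain ⟨f⟩ := hpos
  have hsurj : Function.Surjective f := Finite.surjective_of_injective f.injective
  obtain ⟨a, rfl⟩ := hsurj i
  obtain ⟨b, rfl⟩ := hsurj j
  have : Nonempty (Fin k) := ⟨a⟩
  obtain ⟨p, hp⟩ := hH.exists_walk_length_eq_dist a b
  have h1 := norm_sub_le_of_walk hS (p.map f.toHom)
  rw [SimpleGraph.Walk.length_map, hp] at h1
  refine h1.trans (mul_le_mul_of_nonneg_right ?_ hθ)
  exact_mod_cast SimpleGraph.dist_le_diam (SimpleGraph.connected_iff_ediam_ne_top.1 hH)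

end Kernel

/-! ### Integrals of local kernels against powers of a scaled measure -/

section Asymptotics

/-- Tonelli's theorem for a product of functions of one variable each. -/
theorem lintegral_fin_prod_eq_prod {X : Type*} [MeasurableSpace X] {n : ℕ}
    (μ : Fin n → Measure X) [∀ i, SigmaFinite (μ i)] {f : Fin n → X → ℝ≥0∞}
    (hf : ∀ i, Measurable (f i)) :
    ∫⁻ x, ∏ i, f i (x i) ∂(Measure.pi μ) = ∏ i, ∫⁻ x, f i x ∂(μ i) := by
  induction n with
  | zero => simp
  | succ n ih =>
    have hmp := (measurePreserving_piFinSuccAbove μ 0).symm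
    rw [← hmp.lintegral_comp_emb (MeasurableEquiv.measurableEmbedding _), Fin.prod_univ_succ,
      ← ih (fun i => μ i.succ) fun i => hf i.succ]
    have hm : Measurable fun y : Fin n → X => ∏ i, f i.succ (y i) :=
      Finset.measurable_prod _ fun i _ => (hf _).comp (measurable_pi_apply i)
    rw [← lintegral_prod_mul (hf 0).aemeasurable hm.aemeasurable]
    refine lintegral_congr fun p => ?_
    rw [Fin.prod_univ_succ]
    rfl

theorem pi_withDensity_fin {X : Type*} [MeasurableSpace X] {n : ℕ}
    (μ : Measure X) [SigmaFinite μ] {f : X → ℝ≥0∞} (hf : Measurable f)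
    [SigmaFinite (μ.withDensity f)] :
    Measure.pi (fun _ : Fin n => μ.withDensity f)
      = (Measure.pi fun _ : Fin n => μ).withDensity fun x => ∏ i, f (x i) := by
  refine Measure.pi_eq fun s hs => ?_
  rw [withDensity_apply _ (MeasurableSet.univ_pi hs), Measure.restrict_pi_pi,
    lintegral_fin_prod_eq_prod _ fun _ => hf]
  exact Finset.prod_congr rfl fun i _ => (withDensity_apply _ (hs i)).symm

variable {d n : ℕ}

theorem lintegral_comp_add_smul (v : Fin n → EuclideanSpace ℝ (Fin d)) {r : ℝ} (hr : 0 < r)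
    (f : (Fin n → EuclideanSpace ℝ (Fin d)) → ℝ≥0∞) :
    ∫⁻ y, f y = ENNReal.ofReal (r ^ (n * d)) * ∫⁻ z, f (v + r • z) := by
  have hfr : Module.finrank ℝ (Fin n → EuclideanSpace ℝ (Fin d)) = n * d := by
    rw [Module.finrank_pi_fintype]
    simp
  have h1 : ∫⁻ z, f (v + r • z) = ENNReal.ofReal ((r ^ (n * d))⁻¹) * ∫⁻ y, f y := by
    have h2 := Measure.map_addHaar_smul
      (volume : Measure (Fin n → EuclideanSpace ℝ (Fin d))) hr.ne'
    rw [hfr, abs_of_pos (by positivity)] at h2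
    rw [← lintegral_add_left_eq_self f v, ← smul_eq_mul, ← lintegral_smul_measure, ← h2]
    exact ((Homeomorph.smulOfNeZero r hr.ne').measurableEmbedding.lintegral_map
      (fun y => f (v + y))).symm
  rw [h1, ← mul_assoc, ← ENNReal.ofReal_mul (by positivity), mul_inv_cancel₀ (by positivity),
    ENNReal.ofReal_one, one_mul]

/-- Blowing up around the point with index `0` turns the integral of a local kernel into an
integral over that point and the rescaled relative positions of the others. -/
theorem lintegral_pi_withDensity_eq {m : EuclideanSpace ℝ (Fin d) → ℝ≥0} (hm : Measurable m)
    {r : ℝ} (hr : 0 < r) {g g' : (Fin (n + 1) → EuclideanSpace ℝ (Fin d)) → ℝ≥0∞}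
    (hg' : Measurable g') (hscale : ∀ v y, g' (fun i => v + r • y i) = g y) :
    ∫⁻ x, g' x ∂(Measure.pi fun _ => volume.withDensity fun x => (m x : ℝ≥0∞))
      = ENNReal.ofReal (r ^ (n * d)) * ∫⁻ u, ∫⁻ z : Fin n → EuclideanSpace ℝ (Fin d),
          g (Fin.cons 0 z) * ((m u : ℝ≥0∞) * ∏ i, (m (u + r • z i) : ℝ≥0∞)) := by
  have hm' : Measurable fun x => (m x : ℝ≥0∞) := hm.coe_nnreal_ennreal
  have hprod : Measurable fun x : Fin (n + 1) → EuclideanSpace ℝ (Fin d) =>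
      ∏ i, (m (x i) : ℝ≥0∞) :=
    Finset.measurable_prod _ fun i _ => hm'.comp (measurable_pi_apply i)
  have hmp := (measurePreserving_piFinSuccAbove
    (fun _ : Fin (n + 1) => (volume : Measure (EuclideanSpace ℝ (Fin d)))) 0).symm
  have hmeas : Measurable fun a : EuclideanSpace ℝ (Fin d) × (Fin n → EuclideanSpace ℝ (Fin d)) =>
      ((fun x : Fin (n + 1) → EuclideanSpace ℝ (Fin d) => ∏ i, (m (x i) : ℝ≥0∞)) * g')
        ((MeasurableEquiv.piFinSuccAbove (fun _ => EuclideanSpace ℝ (Fin d)) 0).symm a) :=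
    (hprod.mul hg').comp (MeasurableEquiv.measurable _)
  rw [pi_withDensity_fin volume hm', lintegral_withDensity_eq_lintegral_mul _ hprod hg',
    ← hmp.lintegral_comp_emb (MeasurableEquiv.measurableEmbedding _),
    lintegral_prod _ hmeas.aemeasurable,
    ← lintegral_const_mul' _ _ ENNReal.ofReal_ne_top]
  refine lintegral_congr fun u => ?_
  have h := lintegral_comp_add_smul (fun _ : Fin n => u) hr
    fun y => (∏ i, (m ((Fin.cons u y : Fin (n + 1) → EuclideanSpace ℝ (Fin d)) i) : ℝ≥0∞))
      * g' (Fin.cons u y)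
  refine Eq.trans ?_ (h.trans ?_)
  · refine lintegral_congr fun y => ?_
    have hins : (MeasurableEquiv.piFinSuccAbove (fun _ => EuclideanSpace ℝ (Fin d)) 0).symm (u, y)
        = (Fin.cons u y : Fin (n + 1) → EuclideanSpace ℝ (Fin d)) :=
      Fin.insertNth_zero' u y
    rw [hins]
    rfl
  · congr 1
    refine lintegral_congr fun z => ?_
    have hcons : (Fin.cons u ((fun _ : Fin n => u) + r • z) :
        Fin (n + 1) → EuclideanSpace ℝ (Fin d))
        = fun i => u + r • (Fin.cons 0 z : Fin (n + 1) → EuclideanSpace ℝ (Fin d)) i := by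
      funext i
      refine Fin.cases ?_ (fun i => ?_) i <;> simp
    rw [hcons, hscale, mul_comm, Fin.prod_univ_succ]
    simp

/-- Limit of the rescaled integral. Continuity of the density lets all the points merge into one,
and comparability of the density on the range of the kernel provides the dominating function. -/
theorem tendsto_lintegral_local {m : EuclideanSpace ℝ (Fin d) → ℝ≥0} (hm : Continuous m)
    (hmne : ∃ x, m x ≠ 0) (hmint : ∫⁻ x, (m x : ℝ≥0∞) ^ (n + 1) < ∞)
    {g : (Fin (n + 1) → EuclideanSpace ℝ (Fin d)) → ℝ≥0∞} (hg : Measurable g)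
    {C : ℝ≥0} (hgC : ∀ y, g y ≤ C) {L R : ℝ} (hL : 0 ≤ L)
    (hgL : ∀ y, g y ≠ 0 → ∀ i, ‖y i - y 0‖ ≤ L)
    (hgpos : ∀ y, (∀ i j, ‖y i - y j‖ ≤ 1) → 0 < g y)
    {c : ℝ≥0} (hc : ∀ x y, ‖x - y‖ ≤ L * R → m x ≤ c * m y)
    {ρ : ℕ+ → ℝ} (hρpos : ∀ t, 0 < ρ t) (hρR : ∀ t, ρ t ≤ R) (hρ : Tendsto ρ atTop (𝓝 0)) :
    (∀ t, ∫⁻ u, ∫⁻ z : Fin n → EuclideanSpace ℝ (Fin d),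
      g (Fin.cons 0 z) * ((m u : ℝ≥0∞) * ∏ i, (m (u + ρ t • z i) : ℝ≥0∞)) < ∞) ∧
    ∃ a : ℝ≥0∞, 0 < a ∧ a < ∞ ∧ Tendsto (fun t => ∫⁻ u, ∫⁻ z : Fin n → EuclideanSpace ℝ (Fin d),
      g (Fin.cons 0 z) * ((m u : ℝ≥0∞) * ∏ i, (m (u + ρ t • z i) : ℝ≥0∞))) atTop (𝓝 a) := by
  have hm' : Measurable fun x => (m x : ℝ≥0∞) := hm.measurable.coe_nnreal_ennreal
  have hcons : Measurable fun z : Fin n → EuclideanSpace ℝ (Fin d) =>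
      (Fin.cons 0 z : Fin (n + 1) → EuclideanSpace ℝ (Fin d)) := by
    refine measurable_pi_lambda _ fun i => ?_
    refine Fin.cases ?_ (fun i => ?_) i
    · simp
    · simpa using measurable_pi_apply i
  have hgc : Measurable fun z : Fin n → EuclideanSpace ℝ (Fin d) => g (Fin.cons 0 z) :=
    hg.comp hcons
  let F : ℝ → EuclideanSpace ℝ (Fin d) × (Fin n → EuclideanSpace ℝ (Fin d)) → ℝ≥0∞ := fun r p =>
    g (Fin.cons 0 p.2) * ((m p.1 : ℝ≥0∞) * ∏ i, (m (p.1 + r • p.2 i) : ℝ≥0∞))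
  have hF : ∀ r, Measurable (F r) := fun r => by
    refine (hgc.comp measurable_snd).mul ((hm'.comp measurable_fst).mul ?_)
    refine Finset.measurable_prod _ fun i _ => hm'.comp ?_
    fun_prop
  let K : Set (Fin n → EuclideanSpace ℝ (Fin d)) := Metric.closedBall 0 L
  let bound : EuclideanSpace ℝ (Fin d) × (Fin n → EuclideanSpace ℝ (Fin d)) → ℝ≥0∞ := fun p =>
    (m p.1 : ℝ≥0∞) ^ (n + 1) * K.indicator (fun _ => (C : ℝ≥0∞) * (c : ℝ≥0∞) ^ n) p.2
  have hbound : ∀ t p, F (ρ t) p ≤ bound p := by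
    rintro t ⟨u, z⟩
    by_cases hz : g (Fin.cons 0 z) = 0
    · simp [F, hz]
    · have hzL : ∀ i, ‖z i‖ ≤ L := fun i => by simpa using hgL _ hz i.succ
      have hzK : z ∈ K := by
        rw [mem_closedBall_zero_iff]
        exact (pi_norm_le_iff_of_nonneg hL).2 hzL
      have hmz : ∀ i, (m (u + ρ t • z i) : ℝ≥0∞) ≤ c * m u := fun i => by
        rw [← ENNReal.coe_mul, ENNReal.coe_le_coe]
        refine hc _ _ ?_
        rw [add_sub_cancel_left, norm_smul, Real.norm_of_nonneg (hρpos t).le, mul_comm]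
        exact mul_le_mul (hzL i) (hρR t) (hρpos t).le hL
      have hp : ∏ i, (m (u + ρ t • z i) : ℝ≥0∞) ≤ ((c : ℝ≥0∞) * m u) ^ n :=
        (Finset.prod_le_prod' fun i _ => hmz i).trans (by simp)
      simp only [F, bound, Set.indicator_of_mem hzK]
      calc g (Fin.cons 0 z) * ((m u : ℝ≥0∞) * ∏ i, (m (u + ρ t • z i) : ℝ≥0∞))
          ≤ C * ((m u : ℝ≥0∞) * ((c : ℝ≥0∞) * m u) ^ n) := by gcongr; exact hgC _
        _ = (m u : ℝ≥0∞) ^ (n + 1) * (C * (c : ℝ≥0∞) ^ n) := by ring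
  have hboundint : ∫⁻ p, bound p < ∞ := by
    have hK : MeasurableSet K := Metric.isClosed_closedBall.measurableSet
    rw [Measure.volume_eq_prod, lintegral_prod_mul (hm'.pow_const _).aemeasurable
      (measurable_const.indicator hK).aemeasurable, lintegral_indicator_const hK]
    refine ENNReal.mul_lt_top hmint (ENNReal.mul_lt_top ?_ measure_closedBall_lt_top)
    exact ENNReal.mul_lt_top ENNReal.coe_lt_top (ENNReal.pow_lt_top ENNReal.coe_lt_top)
  have hiter : ∀ r, ∫⁻ u, ∫⁻ z : Fin n → EuclideanSpace ℝ (Fin d),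
      g (Fin.cons 0 z) * ((m u : ℝ≥0∞) * ∏ i, (m (u + r • z i) : ℝ≥0∞)) = ∫⁻ p, F r p :=
    fun r => by
      rw [Measure.volume_eq_prod, lintegral_prod _ (hF r).aemeasurable]
  simp_rw [hiter]
  have hfin : ∀ t, ∫⁻ p, F (ρ t) p < ∞ := fun t =>
    (lintegral_mono (hbound t)).trans_lt hboundint
  have hptlim : ∀ p, Tendsto (fun t => F (ρ t) p) atTop (𝓝 (F 0 p)) := fun p => by
    refine ENNReal.Tendsto.const_mul ?_ ?_
    · have hcont : Continuous fun r : ℝ => m p.1 * ∏ i, m (p.1 + r • p.2 i) := by fun_prop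
      have h := ENNReal.tendsto_coe.2 ((hcont.tendsto 0).comp hρ)
      simpa [Function.comp_def] using h
    · exact Or.inr ((hgC _).trans_lt ENNReal.coe_lt_top).ne
  have hlim : Tendsto (fun t => ∫⁻ p, F (ρ t) p) atTop (𝓝 (∫⁻ p, F 0 p)) :=
    tendsto_lintegral_filter_of_dominated_convergence bound
      (Eventually.of_forall fun t => hF _) (Eventually.of_forall fun t => ae_of_all _ (hbound t))
      hboundint.ne (ae_of_all _ hptlim)
  have hval : ∫⁻ p, F 0 p = (∫⁻ x, (m x : ℝ≥0∞) ^ (n + 1)) *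
      ∫⁻ z : Fin n → EuclideanSpace ℝ (Fin d), g (Fin.cons 0 z) := by
    rw [Measure.volume_eq_prod, ← lintegral_prod_mul (hm'.pow_const _).aemeasurable
      hgc.aemeasurable]
    refine lintegral_congr fun p => ?_
    simp only [F, zero_smul, add_zero, Finset.prod_const, Finset.card_univ, Fintype.card_fin]
    ring
  refine ⟨hfin, _, ?_, ?_, hlim⟩
  · rw [hval]
    refine ENNReal.mul_pos ?_ ?_
    · have hcont : Continuous fun x => (m x : ℝ≥0∞) ^ (n + 1) :=
        (ENNReal.continuous_pow _).comp (ENNReal.continuous_coe.comp hm)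
      rw [Ne, lintegral_eq_zero_iff hcont.measurable, Continuous.ae_eq_iff_eq volume hcont
        continuous_zero]
      obtain ⟨x, hx⟩ := hmne
      intro h
      have := congrFun h x
      simp [hx] at this
    · -- the kernel is positive when all relative positions have norm at most `1 / 2`
      intro h0
      rw [lintegral_eq_zero_iff hgc] at h0
      have hsub : Metric.ball (0 : Fin n → EuclideanSpace ℝ (Fin d)) (1 / 2)
          ⊆ {z | ¬ g (Fin.cons 0 z) = 0} := by
        intro z hz
        refine (hgpos _ ?_).ne'
        rw [mem_ball_zero_iff] at hz
        have hz' : ∀ i, ‖(Fin.cons 0 z : Fin (n + 1) → EuclideanSpace ℝ (Fin d)) i‖ ≤ 1 / 2 := by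
          intro i
          refine Fin.cases ?_ (fun i => ?_) i
          · simp
          · simpa using (norm_le_pi_norm z i).trans hz.le
        intro i j
        refine (norm_sub_le _ _).trans ?_
        linarith [hz' i, hz' j]
      have hball : volume (Metric.ball (0 : Fin n → EuclideanSpace ℝ (Fin d)) (1 / 2)) = 0 :=
        measure_mono_null hsub h0
      exact (Metric.measure_ball_pos volume _ (by norm_num)).ne' hball
  · refine (lintegral_mono fun p => ?_).trans_lt hboundint
    exact le_of_tendsto (hptlim p) (Eventually.of_forall fun t => hbound t p)

end Asymptotics

section Scaling

variable {d : ℕ}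

/-- The measure with density `t * m`. -/
noncomputable def scaledIntensity (m : EuclideanSpace ℝ (Fin d) → ℝ≥0) (t : ℕ+) :
    Measure (EuclideanSpace ℝ (Fin d)) :=
  volume.withDensity fun x => ((((t : ℕ) : ℝ≥0) * m x : ℝ≥0) : ℝ≥0∞)

theorem smul_withDensity_eq_scaledIntensity {m : EuclideanSpace ℝ (Fin d) → ℝ≥0}
    (hm : Measurable m) (t : ℕ+) :
    ((t : ℕ) : ℝ≥0∞) • (volume.withDensity fun x => (m x : ℝ≥0∞)) = scaledIntensity m t := by
  rw [scaledIntensity, ← withDensity_smul _ hm.coe_nnreal_ennreal]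
  congr 1

instance sigmaFinite_scaledIntensity (m : EuclideanSpace ℝ (Fin d) → ℝ≥0) (t : ℕ+) :
    SigmaFinite (scaledIntensity m t) :=
  SigmaFinite.withDensity fun x => ((t : ℕ) : ℝ≥0) * m x

theorem nullSingletonClass_scaledIntensity (hd : 1 ≤ d) (m : EuclideanSpace ℝ (Fin d) → ℝ≥0)
    (t : ℕ+) : NullSingletonClass (scaledIntensity m t) := by
  have : Nonempty (Fin d) := ⟨⟨0, hd⟩⟩
  exact ⟨fun x => withDensity_absolutelyContinuous _ _ (measure_singleton x)⟩

theorem scaledIntensity_lt_top {m : EuclideanSpace ℝ (Fin d) → ℝ≥0} {C : ℝ≥0}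
    (hC : ∀ x, m x ≤ C) (t : ℕ+) {A : Set (EuclideanSpace ℝ (Fin d))}
    (hA : Bornology.IsBounded A) : scaledIntensity m t A < ∞ := by
  refine (withDensity_mono (g := fun _ => ((((t : ℕ) : ℝ≥0) * C : ℝ≥0) : ℝ≥0∞))
    (ae_of_all _ fun x => ?_) A).trans_lt ?_
  · exact ENNReal.coe_le_coe.2 (mul_le_mul_right (hC x) _)
  · rw [withDensity_const, Measure.smul_apply, smul_eq_mul]
    exact ENNReal.mul_lt_top ENNReal.coe_lt_top hA.measure_lt_top

/-- The integral of a local kernel in `p` points on the scale `ρ t` has order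
`t ^ p * ρ t ^ (d * (p - 1))`. Here `r` is an index from which all other points are within the
range `L` of the kernel. -/
theorem exists_tendsto_lintegral_scaledIntensity {ι : Type} [Fintype ι] (r : ι)
    {m : EuclideanSpace ℝ (Fin d) → ℝ≥0} (hm : Continuous m)
    (hmne : ∃ x, m x ≠ 0) (hmint : ∫⁻ x, (m x : ℝ≥0∞) ^ Fintype.card ι < ∞)
    {g : (ι → EuclideanSpace ℝ (Fin d)) → ℝ≥0∞} (hg : Measurable g)
    {g' : ℕ+ → (ι → EuclideanSpace ℝ (Fin d)) → ℝ≥0∞} (hg' : ∀ t, Measurable (g' t))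
    {C : ℝ≥0} (hgC : ∀ y, g y ≤ C) {L R : ℝ} (hL : 0 ≤ L)
    (hgL : ∀ y, g y ≠ 0 → ∀ i, ‖y i - y r‖ ≤ L)
    (hgpos : ∀ y, (∀ i j, ‖y i - y j‖ ≤ 1) → 0 < g y)
    {c : ℝ≥0} (hc : ∀ x y, ‖x - y‖ ≤ L * R → m x ≤ c * m y)
    {ρ : ℕ+ → ℝ} (hρpos : ∀ t, 0 < ρ t) (hρR : ∀ t, ρ t ≤ R) (hρ : Tendsto ρ atTop (𝓝 0))
    (hscale : ∀ t v y, g' t (fun i => v + ρ t • y i) = g y) :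
    (∀ t, ∫⁻ x, g' t x ∂(Measure.pi fun _ => scaledIntensity m t) < ∞) ∧
    ∃ a : ℝ, 0 < a ∧ Tendsto (fun t : ℕ+ =>
      (∫⁻ x, g' t x ∂(Measure.pi fun _ => scaledIntensity m t)).toReal
        / ((t : ℝ) ^ Fintype.card ι * ρ t ^ (d * (Fintype.card ι - 1)))) atTop (𝓝 a) := by
  classical
  obtain ⟨n, hn⟩ : ∃ n, Fintype.card ι = n + 1 :=
    Nat.exists_eq_succ_of_ne_zero (Fintype.card_pos_iff.2 ⟨r⟩).ne'
  obtain ⟨e, he⟩ : ∃ e : ι ≃ Fin (n + 1), e r = 0 := by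
    let e := Fintype.equivFinOfCardEq hn
    exact ⟨e.trans (Equiv.swap (e r) 0), by simp⟩
  have hreindex : Measurable fun (y : Fin (n + 1) → EuclideanSpace ℝ (Fin d)) (i : ι) => y (e i) :=
    by fun_prop
  rw [hn] at hmint ⊢
  obtain ⟨hfin, a, ha0, hatop, ha⟩ := tendsto_lintegral_local hm hmne hmint (hg.comp hreindex)
    (fun y => hgC _) hL
    (fun y hy i => by
      have h := hgL _ hy (e.symm i)
      simpa only [he, e.apply_symm_apply] using h)
    (fun y hy => hgpos _ fun i j => hy _ _) hc hρpos hρR hρ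
  have heq : ∀ t, ∫⁻ x, g' t x ∂(Measure.pi fun _ => scaledIntensity m t)
      = ENNReal.ofReal ((t : ℝ) ^ (n + 1) * ρ t ^ (d * n))
        * ∫⁻ u, ∫⁻ z : Fin n → EuclideanSpace ℝ (Fin d),
          (g ∘ fun (y : Fin (n + 1) → EuclideanSpace ℝ (Fin d)) i => y (e i)) (Fin.cons 0 z)
            * ((m u : ℝ≥0∞) * ∏ i, (m (u + ρ t • z i) : ℝ≥0∞)) := by
    intro t
    have h := lintegral_pi_withDensity_eq (m := fun x => ((t : ℕ) : ℝ≥0) * m x)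
      (measurable_const.mul hm.measurable) (hρpos t) ((hg' t).comp hreindex)
      (g := g ∘ fun (y : Fin (n + 1) → EuclideanSpace ℝ (Fin d)) i => y (e i))
      fun v y => hscale t v _
    rw [lintegral_pi_reindex _ e]
    refine h.trans ?_
    rw [ENNReal.ofReal_mul (by positivity), mul_comm (ENNReal.ofReal _) (ENNReal.ofReal _),
      mul_assoc, mul_comm d n]
    congr 1
    have ht : ENNReal.ofReal ((t : ℝ) ^ (n + 1)) = ((t : ℕ) : ℝ≥0∞) ^ (n + 1) := by
      rw [ENNReal.ofReal_pow (by positivity)]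
      congr 1
      exact ENNReal.ofReal_natCast _
    have httop : ((t : ℕ) : ℝ≥0∞) ^ (n + 1) ≠ ∞ := ENNReal.pow_ne_top (ENNReal.natCast_ne_top _)
    rw [ht, ← lintegral_const_mul' _ _ httop]
    refine lintegral_congr fun u => ?_
    rw [← lintegral_const_mul' _ _ httop]
    refine lintegral_congr fun z => ?_
    push_cast
    rw [Finset.prod_mul_distrib]
    simp only [Finset.prod_const, Finset.card_univ, Fintype.card_fin]
    ring
  have hpos : ∀ t : ℕ+, 0 < (t : ℝ) ^ (n + 1) * ρ t ^ (d * n) := fun t => by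
    have h1 : (0 : ℝ) < (t : ℝ) := by exact_mod_cast t.pos
    have h2 := hρpos t
    positivity
  refine ⟨fun t => ?_, a.toReal, ENNReal.toReal_pos ha0.ne' hatop.ne, ?_⟩
  · rw [heq]
    exact ENNReal.mul_lt_top ENNReal.ofReal_lt_top (hfin t)
  · refine ((ENNReal.tendsto_toReal hatop.ne).comp ha).congr fun t => ?_
    rw [heq, ENNReal.toReal_mul, ENNReal.toReal_ofReal (hpos t).le, Nat.add_sub_cancel,
      mul_div_cancel_left₀ _ (hpos t).ne']
    rfl

end Scaling

/-! ### Medians and asymptotic equivalence -/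

section Analysis

/-- Chebyshev's inequality localizes the median: more than half of the mass lies within `δ` of the
mean. -/
theorem abs_smallestMedian_sub_integral_le {Ω : Type*} [MeasurableSpace Ω] {P : Measure Ω}
    [IsProbabilityMeasure P] {Z : Ω → ℝ} (hZ : MemLp Z 2 P) {δ : ℝ} (hδ : 0 < δ)
    (hvar : variance Z P / δ ^ 2 < 1 / 2) :
    |smallestMedian P Z - ∫ ω, Z ω ∂P| ≤ δ := by
  set e := ∫ ω, Z ω ∂P with he
  have hhalf : ENNReal.ofReal (1 / 2) = 1 / 2 := by
    rw [ENNReal.ofReal_div_of_pos (by norm_num)]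
    simp
  have hcheb : P {ω | δ ≤ |Z ω - e|} < 1 / 2 := by
    refine (meas_ge_le_variance_div_sq hZ hδ).trans_lt ?_
    rw [← hhalf]
    exact (ENNReal.ofReal_lt_ofReal_iff (by norm_num)).2 hvar
  have hmem : (1 / 2 : ℝ≥0∞) ≤ P {ω | Z ω ≤ e + δ} := by
    by_contra! h
    have h1 : (1 : ℝ≥0∞) ≤ P {ω | Z ω ≤ e + δ} + P {ω | δ ≤ |Z ω - e|} := by
      rw [← measure_univ (μ := P)]
      refine (measure_mono fun ω _ => ?_).trans (measure_union_le _ _)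
      by_cases hω : Z ω ≤ e + δ
      · exact Or.inl hω
      · refine Or.inr ?_
        change δ ≤ |Z ω - e|
        exact le_trans (by linarith) (le_abs_self _)
    have h2 := h1.trans_lt (ENNReal.add_lt_add h hcheb)
    rw [ENNReal.add_halves] at h2
    exact lt_irrefl _ h2
  have hlow : ∀ x ∈ {x : ℝ | (1 / 2 : ℝ≥0∞) ≤ P {ω | Z ω ≤ x}}, e - δ ≤ x := by
    intro x hx
    by_contra! hlt
    refine absurd (le_trans (Set.mem_ofPred_eq ▸ hx) (measure_mono fun ω hω => ?_)) hcheb.not_ge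
    have hω' : Z ω ≤ x := hω
    change δ ≤ |Z ω - e|
    rw [abs_sub_comm]
    exact le_trans (by linarith) (le_abs_self _)
  have h1 : smallestMedian P Z ≤ e + δ := csInf_le ⟨e - δ, hlow⟩ hmem
  have h2 : e - δ ≤ smallestMedian P Z := le_csInf ⟨_, hmem⟩ hlow
  rw [abs_le]
  constructor <;> linarith

/-- If the variance is negligible against the square of the mean, median and mean are equivalent. -/
theorem asympEquiv_smallestMedian {Ω : Type*} [MeasurableSpace Ω] {P : Measure Ω}
    [IsProbabilityMeasure P] {Z : ℕ+ → Ω → ℝ} (hZ : ∀ t, MemLp (Z t) 2 P)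
    (hpos : ∀ᶠ t in atTop, 0 < ∫ ω, Z t ω ∂P)
    (hvar : Tendsto (fun t => variance (Z t) P / (∫ ω, Z t ω ∂P) ^ 2) atTop (𝓝 0)) :
    AsympEquiv (fun t => smallestMedian P (Z t)) (fun t => ∫ ω, Z t ω ∂P) := by
  rw [AsympEquiv, Metric.tendsto_nhds]
  intro ε hε
  have hev := (tendsto_order.1 hvar).2 ((ε / 2) ^ 2 / 2) (by positivity)
  filter_upwards [hpos, hev] with t ht hv
  set e := ∫ ω, Z t ω ∂P with he
  have h := abs_smallestMedian_sub_integral_le (hZ t) (δ := ε / 2 * e) (by positivity) (by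
    rw [mul_pow, mul_comm, ← div_div, div_lt_iff₀ (by positivity)]
    linarith)
  rw [Real.dist_eq, div_sub_one ht.ne', abs_div, abs_of_pos ht, div_lt_iff₀ ht]
  refine h.trans_lt ?_
  have := mul_pos hε ht
  linarith

/-- Asymptotic equivalences between positive functions can be added: the quotient of the sums is a
weighted mean of the quotients. -/
theorem AsympEquiv.sum {σ : Type*} {s : Finset σ} (hs : s.Nonempty) {u v : σ → ℕ+ → ℝ}
    (hv : ∀ i ∈ s, ∀ t, 0 < v i t) (h : ∀ i ∈ s, AsympEquiv (u i) (v i)) :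
    AsympEquiv (fun t => ∑ i ∈ s, u i t) (fun t => ∑ i ∈ s, v i t) := by
  have hV : ∀ t, 0 < ∑ i ∈ s, v i t := fun t => Finset.sum_pos (fun i hi => hv i hi t) hs
  rw [AsympEquiv, tendsto_iff_norm_sub_tendsto_zero]
  have hb : Tendsto (fun t => ∑ i ∈ s, ‖u i t / v i t - 1‖) atTop (𝓝 0) := by
    rw [← Finset.sum_const_zero (s := s)]
    exact tendsto_finsetSum _ fun i hi => tendsto_iff_norm_sub_tendsto_zero.1 (h i hi)
  refine squeeze_zero (fun t => norm_nonneg _) (fun t => ?_) hb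
  rw [div_sub_one (hV t).ne', ← Finset.sum_sub_distrib, norm_div, Real.norm_of_nonneg (hV t).le,
    div_le_iff₀ (hV t), Finset.sum_mul]
  refine (norm_sum_le _ _).trans (Finset.sum_le_sum fun i hi => ?_)
  have h1 : u i t - v i t = (u i t / v i t - 1) * v i t := by
    field_simp [(hv i hi t).ne']
  rw [h1, norm_mul, Real.norm_of_nonneg (hv i hi t).le]
  exact mul_le_mul_of_nonneg_left
    (Finset.single_le_sum (f := fun i => v i t) (fun j hj => (hv j hj t).le) hi) (norm_nonneg _)

/-- If `t * x ^ N` tends to infinity, then so does `t * x ^ n` for every `n ≤ N`: for `x ≥ 1` it is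
at least `t`, for `x < 1` at least `t * x ^ N`. -/
theorem tendsto_mul_pow_atTop {x : ℕ+ → ℝ} (hx : ∀ t, 0 < x t) {n N : ℕ} (hn : n ≤ N)
    (h : Tendsto (fun t : ℕ+ => (t : ℝ) * x t ^ N) atTop atTop) :
    Tendsto (fun t : ℕ+ => (t : ℝ) * x t ^ n) atTop atTop := by
  have ht : Tendsto (fun t : ℕ+ => (t : ℝ)) atTop atTop :=
    tendsto_natCast_atTop_atTop.comp tendsto_PNat_val_atTop_atTop
  rw [tendsto_atTop] at h ht ⊢
  intro b
  filter_upwards [h b, ht b] with t h1 h2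
  have ht0 : (0 : ℝ) ≤ t := by positivity
  rcases le_total 1 (x t) with hx1 | hx1
  · exact h2.trans (le_mul_of_one_le_right ht0 (one_le_pow₀ hx1))
  · exact h1.trans (mul_le_mul_of_nonneg_left (pow_le_pow_of_le_one (hx t).le hx1 hn) ht0)

end Analysis

/-! ### Coincidence patterns of two copies of the graph -/

section CopyPatterns

variable {d k : ℕ}

theorem PairPattern.card_index_disjoint (k : ℕ) :
    Fintype.card (PairPattern.disjoint (Fin k) (Fin k)).Index = 2 * k := by
  have hbij : Function.Bijective (PairPattern.disjoint (Fin k) (Fin k)).mk :=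
    ⟨fun a b h => (PairPattern.mk_eq_mk _).1 h, PairPattern.mk_surjective _⟩
  rw [← Fintype.card_of_bijective hbij, Fintype.card_sum, Fintype.card_fin, two_mul]

theorem PairPattern.exists_mk_eq {A B : Type} {s : PairPattern A B}
    (hs : s ≠ PairPattern.disjoint A B) : ∃ i j, s.mk (.inl i) = s.mk (.inr j) := by
  by_contra! h
  refine hs (Subtype.ext (Setoid.ext fun a b => ?_))
  rw [← s.mk_eq_mk]
  change s.mk a = s.mk b ↔ a = b
  refine ⟨fun hab => ?_, fun hab => hab ▸ rfl⟩
  rcases a with i | i <;> rcases b with j | j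
  · exact congrArg _ (s.mk_inl_injective hab)
  · exact absurd hab (h i j)
  · exact absurd hab.symm (h j i)
  · exact congrArg _ (s.mk_inr_injective hab)

theorem PairPattern.le_card_index (s : PairPattern (Fin k) (Fin k)) : k ≤ Fintype.card s.Index := by
  simpa using Fintype.card_le_of_injective _ s.mk_inl_injective

theorem PairPattern.card_index_lt {s : PairPattern (Fin k) (Fin k)}
    (hs : s ≠ PairPattern.disjoint _ _) : Fintype.card s.Index < 2 * k := by
  obtain ⟨i, j, hij⟩ := PairPattern.exists_mk_eq hs
  have h := Fintype.card_lt_of_surjective_not_injective _ s.mk_surjective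
    fun hinj => Sum.inl_ne_inr (hinj hij)
  simpa [two_mul] using h

/-- Every number `n` of common points is realized by some pattern: number the distinct points such
that the first tuple occupies the positions `0, …, k - 1` and the second one the positions
`k - n, …, 2 * k - n - 1`. -/
theorem PairPattern.exists_card_index_eq {n : ℕ} (hn : n ≤ k) :
    ∃ s : PairPattern (Fin k) (Fin k), Fintype.card s.Index = 2 * k - n := by
  let number : Fin k ⊕ Fin k → Fin (2 * k - n) := Sum.elim (fun i => ⟨i, by omega⟩)
    fun j => ⟨j + (k - n), by omega⟩
  have hsurj : Function.Surjective number := by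
    intro a
    by_cases ha : a.1 < k
    · exact ⟨.inl ⟨a, ha⟩, rfl⟩
    · refine ⟨.inr ⟨a - (k - n), by omega⟩, Fin.ext ?_⟩
      change a.1 - (k - n) + (k - n) = a.1
      omega
  have hinl : ∀ i j, number (.inl i) = number (.inl j) → i = j := fun i j h => by
    have h' := congrArg Fin.val h
    exact Fin.ext h'
  have hinr : ∀ i j, number (.inr i) = number (.inr j) → i = j := fun i j h => by
    have h' := congrArg Fin.val h
    exact Fin.ext (Nat.add_right_cancel h')
  let s : PairPattern (Fin k) (Fin k) := ⟨Setoid.ker number, hinl, hinr⟩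
  refine ⟨s, ?_⟩
  have e : s.Index ≃ Fin (2 * k - n) := Setoid.quotientKerEquivOfSurjective number hsurj
  rw [Fintype.card_congr e, Fintype.card_fin]

/-- Two copies of a connected graph that share a point stay within the range of one copy around
that point. -/
theorem PairPattern.exists_norm_sub_le {H : SimpleGraph (Fin k)} (hH : H.Connected)
    {S : Set (EuclideanSpace ℝ (Fin d))} {θ : ℝ} (hθ : 0 ≤ θ) (hS : S ⊆ Metric.closedBall 0 θ)
    {s : PairPattern (Fin k) (Fin k)} (hs : s ≠ PairPattern.disjoint _ _) :
    ∃ r : s.Index, ∀ w : s.Index → EuclideanSpace ℝ (Fin d),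
      s.kernel (fun x => copyWeight H (labelGraph S x)) (fun x => copyWeight H (labelGraph S x)) w
        ≠ 0 → ∀ q, ‖w q - w r‖ ≤ H.diam * θ := by
  obtain ⟨i, j, hij⟩ := PairPattern.exists_mk_eq hs
  refine ⟨s.mk (.inl i), fun w hw q => ?_⟩
  obtain ⟨a, rfl⟩ := s.mk_surjective q
  rcases a with a | a
  · exact norm_sub_le_of_copyWeight_ne_zero hH hθ hS (left_ne_zero_of_mul hw) a i
  · rw [hij]
    exact norm_sub_le_of_copyWeight_ne_zero hH hθ hS (right_ne_zero_of_mul hw) a j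

end CopyPatterns

/-! ### Moments of the subgraph counts -/

section Moments

theorem memLp_two_toReal {Ω : Type*} [MeasurableSpace Ω] {P : Measure Ω} [IsProbabilityMeasure P]
    {N : Ω → ℝ≥0∞} (hN : Measurable N) (h2 : ∫⁻ ω, N ω ^ 2 ∂P < ∞) :
    (∀ᵐ ω ∂P, N ω < ∞) ∧ MemLp (fun ω => (N ω).toReal) 2 P := by
  have hae : ∀ᵐ ω ∂P, N ω < ∞ := by
    filter_upwards [ae_lt_top (hN.pow_const 2) h2.ne] with ω hω
    rw [lt_top_iff_ne_top] at hω ⊢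
    exact fun h => hω (by simp [h])
  refine ⟨hae, (memLp_two_iff_integrable_sq hN.ennreal_toReal.aestronglyMeasurable).2 ?_⟩
  simp_rw [← ENNReal.toReal_pow]
  exact integrable_toReal_of_lintegral_ne_top (hN.pow_const 2).aemeasurable h2.ne

/-- If the second moment exceeds the square of the mean by `v`, then `v` is the variance. -/
theorem variance_toReal_eq {Ω : Type*} [MeasurableSpace Ω] {P : Measure Ω} [IsProbabilityMeasure P]
    {N : Ω → ℝ≥0∞} (hN : Measurable N) {e v : ℝ≥0∞} (he : ∫⁻ ω, N ω ∂P = e) (hetop : e < ∞)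
    (hvtop : v < ∞) (h2 : ∫⁻ ω, N ω ^ 2 ∂P = e ^ 2 + v) :
    variance (fun ω => (N ω).toReal) P = v.toReal := by
  have h2top : ∫⁻ ω, N ω ^ 2 ∂P < ∞ := by
    rw [h2]
    exact ENNReal.add_lt_top.2 ⟨ENNReal.pow_lt_top hetop, hvtop⟩
  obtain ⟨hae, hmem⟩ := memLp_two_toReal hN h2top
  rw [variance_eq_sub hmem, integral_toReal hN.aemeasurable hae, he]
  have h3 : ∫ ω, ((fun ω => (N ω).toReal) ^ 2) ω ∂P = (e ^ 2 + v).toReal := by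
    rw [← h2, ← integral_toReal (hN.pow_const 2).aemeasurable]
    · exact integral_congr_ae (ae_of_all _ fun ω => (ENNReal.toReal_pow _ _).symm)
    · filter_upwards [hae] with ω hω using ENNReal.pow_lt_top hω
  rw [h3, ENNReal.toReal_add (ENNReal.pow_lt_top hetop).ne hvtop.ne, ENNReal.toReal_pow]
  ring

theorem le_ciSup_of_tendsto_zero {ρ : ℕ+ → ℝ} (hρ : Tendsto ρ atTop (𝓝 0)) (t : ℕ+) :
    ρ t ≤ ⨆ t, ρ t := by
  refine le_ciSup ?_ t
  have h := (hρ.comp OrderIso.pnatIsoNat.symm.tendsto_atTop).bddAbove_range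
  rwa [OrderIso.pnatIsoNat.symm.surjective.range_comp] at h

/-- For a bounded density higher powers are integrable when a lower one is. -/
theorem lintegral_pow_lt_top_of_le {X : Type*} [MeasurableSpace X] {μ : Measure X} {m : X → ℝ≥0}
    {C : ℝ≥0} (hC : ∀ x, m x ≤ C) {k p : ℕ} (hkp : k ≤ p) (h : ∫⁻ x, (m x : ℝ≥0∞) ^ k ∂μ < ∞) :
    ∫⁻ x, (m x : ℝ≥0∞) ^ p ∂μ < ∞ := by
  have hle : ∀ x, (m x : ℝ≥0∞) ^ p ≤ (C : ℝ≥0∞) ^ (p - k) * (m x : ℝ≥0∞) ^ k := fun x => by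
    obtain ⟨j, rfl⟩ := Nat.exists_eq_add_of_le hkp
    rw [Nat.add_sub_cancel_left, pow_add, mul_comm]
    gcongr
    exact hC x
  refine (lintegral_mono hle).trans_lt ?_
  rw [lintegral_const_mul' _ _ (ENNReal.pow_ne_top ENNReal.coe_ne_top)]
  exact ENNReal.mul_lt_top (ENNReal.pow_lt_top ENNReal.coe_lt_top) h

/-- The order of a pattern with `2 * k - n` points, in the form in which it enters the variance. -/
theorem scale_eq {t r : ℝ} {d k n : ℕ} (hn1 : 1 ≤ n) (hn : n ≤ k) :
    t ^ (2 * k - n) * r ^ (d * (2 * k - n - 1))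
      = t ^ k * r ^ (d * (k - 1)) * (t * r ^ d) ^ (k - n) := by
  obtain ⟨j, rfl⟩ := Nat.exists_eq_add_of_le hn
  have h1 : 2 * (n + j) - n = n + j + j := by omega
  have h2 : n + j + j - 1 = (n + j - 1) + j := by omega
  rw [h1, h2, Nat.add_sub_cancel_left, mul_add, pow_add, pow_add, mul_pow, ← pow_mul]
  ring

end Moments

/-! ### The asymptotics of mean, median and variance -/

/-- If the mean has order `t * x ^ (k - 1)` and tends to infinity, then a term of the variance of
order `t * x ^ (k - 1) * x ^ (k - n)` is negligible against the square of the mean. -/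
theorem tendsto_div_sq_zero {e J x : ℕ+ → ℝ} (hx : ∀ t, 0 < x t) {k n : ℕ} (hn1 : 1 ≤ n)
    (hn : n ≤ k) {a b : ℝ} (ha : 0 < a)
    (he : Tendsto (fun t : ℕ+ => e t / ((t : ℝ) * x t ^ (k - 1))) atTop (𝓝 a))
    (hJ : Tendsto (fun t : ℕ+ => J t / ((t : ℝ) * x t ^ (k - 1) * x t ^ (k - n))) atTop (𝓝 b))
    (hetop : Tendsto e atTop atTop) :
    Tendsto (fun t => J t / e t ^ 2) atTop (𝓝 0) := by
  have ht : ∀ t : ℕ+, (0 : ℝ) < t := fun t => by exact_mod_cast t.pos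
  have hW : Tendsto (fun t : ℕ+ => (t : ℝ) * x t ^ (k - 1)) atTop atTop := by
    refine (hetop.atTop_mul_pos (inv_pos.2 ha) (he.inv₀ ha.ne')).congr' ?_
    filter_upwards [hetop.eventually_gt_atTop 0] with t het
    have := ht t
    have := hx t
    field_simp
  have h1 := tendsto_mul_pow_atTop hx (n := n - 1) (by omega) hW
  have h2 := (hJ.mul h1.inv_tendsto_atTop).mul ((he.inv₀ ha.ne').pow 2)
  rw [mul_zero, zero_mul] at h2
  refine h2.congr' ?_
  filter_upwards [hetop.eventually_gt_atTop 0] with t het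
  have h3 := ht t
  have h4 := hx t
  have h5 : x t ^ (k - 1) = x t ^ (k - n) * x t ^ (n - 1) := by
    rw [← pow_add]
    congr 1
    omega
  simp only [Pi.inv_apply, h5]
  field_simp

theorem theorem4p2 {Ω : Type*} [MeasurableSpace Ω] (P : Measure Ω) [IsProbabilityMeasure P]
    (d : ℕ) (hd : 1 ≤ d)
    (k : ℕ) (H : SimpleGraph (Fin k)) (hH : H.Connected)
    (S : Set (EuclideanSpace ℝ (Fin d))) (hSmeas : MeasurableSet S) (hSsymm : S = -S)
    (θ : ℝ) (hθ : 1 ≤ θ)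
    (hSlow : Metric.closedBall 0 1 ⊆ S) (hSup : S ⊆ Metric.closedBall 0 θ)
    (ρ : ℕ+ → ℝ) (hρpos : ∀ t, 0 < ρ t) (hρlim : Tendsto ρ atTop (𝓝 0))
    (m : EuclideanSpace ℝ (Fin d) → ℝ≥0) (hmcont : Continuous m)
    (hmbdd : ∃ C : ℝ≥0, ∀ x, m x ≤ C)
    (hmne : ∃ x, m x ≠ 0)
    (hmcomp : ∃ c : ℝ≥0, 1 ≤ c ∧
      ∀ x y, ‖x - y‖ ≤ (H.diam : ℝ) * θ * (⨆ t, ρ t) → m x ≤ c * m y)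
    (hmint : ∫⁻ x, (m x : ℝ≥0∞) ^ k < ∞)
    (η : ℕ+ → Ω → PointConfig d)
    (hη : ∀ t : ℕ+, IsPoissonProcess P
      (((t : ℕ) : ℝ≥0∞) • (volume.withDensity (fun x => (m x : ℝ≥0∞)))) (η t))
    (N : ℕ+ → Ω → ℝ≥0∞)
    (hN : ∀ t ω, N t ω = subgraphCount H (ρ t • S) (η t ω)) :
    -- the counts are almost surely finite and square-integrable, so that mean and variance exist
    (∀ t, (∀ᵐ ω ∂P, N t ω < ∞) ∧ MemLp (fun ω => (N t ω).toReal) 2 P) ∧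
    -- (i)
    (∃ a : ℝ, 0 < a ∧
      AsympEquiv (fun t => ∫ ω, (N t ω).toReal ∂P)
        (fun t => a * (t : ℝ) ^ k * ρ t ^ (d * (k - 1)))) ∧
    -- (ii)
    (Tendsto (fun t => ∫ ω, (N t ω).toReal ∂P) atTop atTop →
      AsympEquiv (fun t => smallestMedian P (fun ω => (N t ω).toReal))
        (fun t => ∫ ω, (N t ω).toReal ∂P)) ∧
    -- (iii)
    (∃ A : ℕ → ℝ, (∀ n, 1 ≤ n → n ≤ k → 0 < A n) ∧
      AsympEquiv (fun t => variance (fun ω => (N t ω).toReal) P)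
        (fun t => (t : ℝ) ^ k * ρ t ^ (d * (k - 1)) *
          ∑ n ∈ Finset.Icc 1 k, ((t : ℝ) * ρ t ^ d) ^ (k - n) * A n)) := by
  classical
  have hk : 1 ≤ k := by
    obtain ⟨i⟩ := hH.nonempty
    exact i.pos
  have hθ0 : 0 ≤ θ := zero_le_one.trans hθ
  have hL : 0 ≤ (H.diam : ℝ) * θ := mul_nonneg (Nat.cast_nonneg _) hθ0
  obtain ⟨C, hC⟩ := hmbdd
  obtain ⟨c, -, hc⟩ := hmcomp
  obtain ⟨D, hD⟩ := exists_copyWeight_le H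
  have hρR := le_ciSup_of_tendsto_zero hρlim
  have hm := hmcont.measurable
  simp_rw [smul_withDensity_eq_scaledIntensity hm] at hη
  have hns := fun t => nullSingletonClass_scaledIntensity hd m t
  have hfin := fun t A (hA : Bornology.IsBounded A) => scaledIntensity_lt_top hC t hA
  let f0 : (Fin k → EuclideanSpace ℝ (Fin d)) → ℝ≥0∞ := fun x => copyWeight H (labelGraph S x)
  let f : ℕ+ → (Fin k → EuclideanSpace ℝ (Fin d)) → ℝ≥0∞ :=
    fun t x => copyWeight H (labelGraph (ρ t • S) x)
  have hf0 : Measurable f0 := measurable_copyWeight_labelGraph H hSmeas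
  have hf : ∀ t, Measurable (f t) := fun t =>
    measurable_copyWeight_labelGraph H (hSmeas.const_smul₀ (ρ t))
  have hNf : ∀ t ω, N t ω = ∫⁻ x, f t x ∂(factorialMeasure (Fin k) (η t ω)) := fun t ω => by
    rw [hN, subgraphCount_eq_lintegral]
  have hNmeas : ∀ t, Measurable (N t) := fun t => by
    rw [show N t = _ from funext (hNf t)]
    exact (hη t).measurable_lintegral_factorialMeasure (hf t)
  -- the mean and the contributions of the coincidence patterns to the variance
  let I : ℕ+ → ℝ≥0∞ := fun t => ∫⁻ x, f t x ∂(Measure.pi fun _ => scaledIntensity m t)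
  let J : PairPattern (Fin k) (Fin k) → ℕ+ → ℝ≥0∞ := fun s t =>
    ∫⁻ w, s.kernel (f t) (f t) w ∂(Measure.pi fun _ => scaledIntensity m t)
  let T : Finset (PairPattern (Fin k) (Fin k)) :=
    Finset.univ.filter fun s => s ≠ PairPattern.disjoint (Fin k) (Fin k)
  have hscale : ∀ t v (y : Fin k → EuclideanSpace ℝ (Fin d)),
      f t (fun i => v + ρ t • y i) = f0 y := fun t v y => by
    simp only [f, f0, labelGraph_smul S (hρpos t).ne']
  have hpos0 : ∀ y : Fin k → EuclideanSpace ℝ (Fin d), (∀ i j, ‖y i - y j‖ ≤ 1) → 0 < f0 y :=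
    fun y hy => by
      simp only [f0, labelGraph_eq_top hSlow hy]
      exact copyWeight_top_pos H
  have hI : (∀ t, I t < ∞) ∧ ∃ a : ℝ, 0 < a ∧ Tendsto (fun t : ℕ+ =>
      (I t).toReal / ((t : ℝ) ^ k * ρ t ^ (d * (k - 1)))) atTop (𝓝 a) := by
    have h := exists_tendsto_lintegral_scaledIntensity (⟨0, hk⟩ : Fin k) hmcont hmne
      (by rwa [Fintype.card_fin]) hf0 hf (fun y => hD _) hL
      (fun y hy i => norm_sub_le_of_copyWeight_ne_zero hH hθ0 hSup hy i _) hpos0 hc hρpos hρR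
      hρlim hscale
    rwa [Fintype.card_fin] at h
  have hJ : ∀ s ∈ T, (∀ t, J s t < ∞) ∧ ∃ a : ℝ, 0 < a ∧ Tendsto (fun t : ℕ+ =>
      (J s t).toReal / ((t : ℝ) ^ Fintype.card s.Index
        * ρ t ^ (d * (Fintype.card s.Index - 1)))) atTop (𝓝 a) := by
    intro s hs
    obtain ⟨r, hr⟩ := PairPattern.exists_norm_sub_le hH hθ0 hSup (Finset.mem_filter.1 hs).2
    refine exists_tendsto_lintegral_scaledIntensity r hmcont hmne
      (lintegral_pow_lt_top_of_le hC s.le_card_index hmint) (s.measurable_kernel hf0 hf0)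
      (fun t => s.measurable_kernel (hf t) (hf t)) (C := D * D) (fun y => ?_) hL hr
      (fun y hy => ?_) hc hρpos hρR hρlim fun t v y => ?_
    · rw [ENNReal.coe_mul]
      exact mul_le_mul' (hD _) (hD _)
    · exact ENNReal.mul_pos (hpos0 _ fun i j => hy _ _).ne' (hpos0 _ fun i j => hy _ _).ne'
    · simp only [PairPattern.kernel, hscale]
  obtain ⟨hIfin, a, ha, hIlim⟩ := hI
  have hVfin : ∀ t, ∑ s ∈ T, J s t < ∞ := fun t =>
    ENNReal.sum_lt_top.2 fun s hs => (hJ s hs).1 t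
  choose! b hb hJlim using fun s hs => (hJ s hs).2
  have hmean : ∀ t, ∫⁻ ω, N t ω ∂P = I t := fun t => by
    have := hns t
    simp_rw [hNf]
    exact (hη t).lintegral_factorialMeasure (hfin t) (hf t)
  have hsq : ∀ t, ∫⁻ ω, N t ω ^ 2 ∂P = I t ^ 2 + ∑ s ∈ T, J s t := fun t => by
    have := hns t
    simp_rw [hNf]
    exact (hη t).lintegral_sq (hfin t) (hf t)
  have hmem : ∀ t, (∀ᵐ ω ∂P, N t ω < ∞) ∧ MemLp (fun ω => (N t ω).toReal) 2 P := fun t =>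
    memLp_two_toReal (hNmeas t) (by
      rw [hsq]
      exact ENNReal.add_lt_top.2 ⟨ENNReal.pow_lt_top (hIfin t), hVfin t⟩)
  have hE : ∀ t, ∫ ω, (N t ω).toReal ∂P = (I t).toReal := fun t => by
    rw [integral_toReal (hNmeas t).aemeasurable (hmem t).1, hmean]
  have hV : ∀ t, variance (fun ω => (N t ω).toReal) P = ∑ s ∈ T, (J s t).toReal := fun t => by
    rw [variance_toReal_eq (hNmeas t) (hmean t) (hIfin t) (hVfin t) (hsq t),
      ENNReal.toReal_sum fun s hs => ((hJ s hs).1 t).ne]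
  have htpos : ∀ t : ℕ+, (0 : ℝ) < t := fun t => by exact_mod_cast t.pos
  -- `2 * k - card s.Index` is the number of common points of the two copies
  have hcard : ∀ s ∈ T, k ≤ Fintype.card s.Index ∧ Fintype.card s.Index < 2 * k := fun s hs =>
    ⟨s.le_card_index, PairPattern.card_index_lt (Finset.mem_filter.1 hs).2⟩
  have hord : ∀ s ∈ T, ∀ t : ℕ+, (t : ℝ) ^ Fintype.card s.Index
      * ρ t ^ (d * (Fintype.card s.Index - 1))
      = (t : ℝ) ^ k * ρ t ^ (d * (k - 1))
        * ((t : ℝ) * ρ t ^ d) ^ (k - (2 * k - Fintype.card s.Index)) := fun s hs t => by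
    obtain ⟨h1, h2⟩ := hcard s hs
    rw [← scale_eq (by omega) (by omega), Nat.sub_sub_self h2.le]
  refine ⟨hmem, ⟨a, ha, ?_⟩, fun htop => ?_, ?_⟩
  · simp_rw [AsympEquiv, hE]
    have h := hIlim.div_const a
    rw [div_self ha.ne'] at h
    refine h.congr fun t => ?_
    rw [div_div]
    congr 1
    ring
  · refine asympEquiv_smallestMedian (fun t => (hmem t).2) (htop.eventually_gt_atTop 0) ?_
    simp_rw [hE] at htop
    simp_rw [hE, hV, Finset.sum_div]
    rw [← Finset.sum_const_zero (s := T)]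
    refine tendsto_finsetSum _ fun s hs => ?_
    obtain ⟨h1, h2⟩ := hcard s hs
    have hW : ∀ t : ℕ+, (t : ℝ) ^ k * ρ t ^ (d * (k - 1))
        = (t : ℝ) * ((t : ℝ) * ρ t ^ d) ^ (k - 1) := fun t => by
      rw [mul_pow, ← pow_mul, ← mul_assoc, mul_pow_sub_one (by omega)]
    refine tendsto_div_sq_zero (x := fun t => (t : ℝ) * ρ t ^ d)
      (fun t => mul_pos (htpos t) (pow_pos (hρpos t) d)) (n := 2 * k - Fintype.card s.Index)
      (k := k) (by omega) (by omega) ha ?_ (b := b s) ?_ htop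
    · simpa only [hW] using hIlim
    · have h := hJlim s hs
      simpa only [hord s hs, hW] using h
  · refine ⟨fun n => ∑ s ∈ T with 2 * k - Fintype.card s.Index = n, b s, fun n hn1 hn => ?_, ?_⟩
    · refine Finset.sum_pos (fun s hs => hb s (Finset.mem_filter.1 hs).1) ?_
      obtain ⟨s, hs⟩ := PairPattern.exists_card_index_eq hn
      refine ⟨s, Finset.mem_filter.2 ⟨Finset.mem_filter.2 ⟨Finset.mem_univ _, ?_⟩, by omega⟩⟩
      rintro rfl
      rw [PairPattern.card_index_disjoint] at hs
      omega
    · have hT : T.Nonempty := by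
        obtain ⟨s, hs⟩ := PairPattern.exists_card_index_eq hk
        refine ⟨s, Finset.mem_filter.2 ⟨Finset.mem_univ _, ?_⟩⟩
        rintro rfl
        rw [PairPattern.card_index_disjoint] at hs
        omega
      have hsum : ∀ t : ℕ+, (t : ℝ) ^ k * ρ t ^ (d * (k - 1)) *
          ∑ n ∈ Finset.Icc 1 k, ((t : ℝ) * ρ t ^ d) ^ (k - n)
            * ∑ s ∈ T with 2 * k - Fintype.card s.Index = n, b s
          = ∑ s ∈ T, (t : ℝ) ^ Fintype.card s.Index
            * ρ t ^ (d * (Fintype.card s.Index - 1)) * b s := by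
        intro t
        rw [← Finset.sum_fiberwise_of_maps_to (s := T) (t := Finset.Icc 1 k)
          (g := fun s => 2 * k - Fintype.card s.Index) (fun s hs => by
            obtain ⟨h1, h2⟩ := hcard s hs
            exact Finset.mem_Icc.2 ⟨by omega, by omega⟩), Finset.mul_sum]
        refine Finset.sum_congr rfl fun n hn => ?_
        rw [Finset.mul_sum, Finset.mul_sum]
        refine Finset.sum_congr rfl fun s hs => ?_
        obtain ⟨hs, hsn⟩ := Finset.mem_filter.1 hs
        rw [hord s hs, hsn]
        ring
      simp_rw [hV, hsum]
      refine AsympEquiv.sum hT (fun s hs t => ?_) fun s hs => ?_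
      · exact mul_pos (mul_pos (pow_pos (htpos t) _) (pow_pos (hρpos t) _)) (hb s hs)
      · have h := (hJlim s hs).div_const (b s)
        rw [div_self (hb s hs).ne'] at h
        exact h.congr fun t => div_div _ _ _
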